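/- Let $\Bbbk$ be an algebraically closed field of characteristic $0$, let $m\ge n\ge 1$ be integers with $\gcd(n,m)=1$, and let $\alpha,\beta\in\Bbbk$ with $\beta\ne 0$. Let $$A=\Bbbk\langle x,y\rangle/(x^2y-\beta yx^2-\alpha xyx,\ xy^2-\beta y^2x-\alpha yxy)$$ be the down-up algebra, graded by $\deg x=n$, $\deg y=m$, put $\ell=2(n+m)$, and let $\nabla A$ be its Beilinson algebra, the algebra of upper triangular $\ell\times\ell$ matrices whose $(i,j)$ entry lies in $A_{j-i}$ for $i\le j$. Let $e_i$ ($1\le i\le \ell$) be the diagonal idempotents, let $x_i$ ($1\le i\le n+2m$) be the matrix with single entry $x$ at position $(i,i+n)$, and $y_j$ ($1\le j\le 2n+m$) the matrix with single entry $y$ at position $(j,j+m)$. Write $s(x_i)=e_i$, $t(x_i)=e_{i+n}$, $s(y_j)=e_j$, $t(y_j)=e_{j+m}$. The relations of the corresponding quiver are $f_i=x_ix_{i+n}y_{i+2n}-\alpha x_iy_{i+n}x_{i+n+m}-\beta y_ix_{i+m}x_{i+n+m}$ $(1\le i\le m)$ and $g_j=x_jy_{j+n}y_{j+n+m}-\alpha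 y_jx_{j+m}y_{j+n+m}-\beta y_jy_{j+m}x_{j+2m}$ $(1\le j\le n)$, each with source $s$ and target $t$ equal to those of its paths. Let $P^r=\bigoplus_{h}\nabla A\,s(h)\otimes_{\Bbbk} t(h)\,\nabla A$, where $h$ runs over the vertices $e_i$ (with $s(e_i)=t(e_i)=e_i$) for $r=0$, the arrows $x_i,y_j$ for $r=1$, and the relations $f_i,g_j$ for $r=2$. Let $$P^2\xrightarrow{\partial^2}P^1\xrightarrow{\partial^1}P^0\xrightarrow{\partial^0}\nabla A\to 0$$ be the start of the standard projective bimodule resolution: $\partial^0$ is multiplication, $\partial^1(s(h)\otimes t(h))=(s(h)\otimes s(h))h-h(t(h)\otimes t(h))$, and $\partial^2$ sends the generator of a relation to the corresponding linear combination of the elements $(s(a)\otimes t(a))bc+a(s(b)\otimes t(b))c+ab(s(c)\otimes t(c))$ over the paths $abc$ in that relation. The class of a cocycle $f:P^1\to\nabla A$ (a bimodule map with $f\partial^2=0$) in $\mathrm{HH}^1(\nabla A)=\mathrm{Ext}^1(\nabla A,\nabla A)$ (Ext of $\nabla A$-bimodules) is written $[f]$. Let $\tau_{x_i}$ (resp.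 $\tau_{y_j}$) be the bimodule map $P^1\to\nabla A$ sending the generator $s(h)\otimes t(h)$ to $h$ if $h=x_i$ (resp. $h=y_j$) and to $0$ otherwise. If $n=1$, let $\tau_{y_j}^{x^m}$ send the generator of $y_j$ to $x_jx_{j+1}\cdots x_{j+m-1}$ and the other generators to $0$. If $n=m=1$, write $\tau_{y_j}^{x}$ for $\tau_{y_j}^{x^m}$, and let $\tau_{x_i}^{y}$ send the generator of $x_i$ to $y_i$ and the other generators to $0$. Define $\lambda_{-1}=\beta^{-1}$, $\lambda_0=0$, $\lambda_{r+2}=\alpha\lambda_{r+1}+\beta\lambda_r$. Say that Case I holds if $n+m$ is even and $\alpha=0$, and Case II otherwise. Say that Case 1 holds if $\lambda_{m+1}=0$, Case 2 if $\lambda_{m+1}\neq0$ and $\alpha^2+4\beta=0$, and Case 3 if $\lambda_{m+1}\ne0$ and $\alpha^2+4\beta\neq 0$. (For $n=1$, Case I implies Case 1; for $n=m=1$ the two are equivalent.) Put $\sigma=\sum_{r=1}^{n+2m}\tau_{x_r}$ and $\delta=\sum_{r=1}^{m}(-1)^{r-1}\tau_{x_{n+r}}$. Then $\sigma$ is never a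 coboundary (it is not of the form $\phi\,\partial^1$ with $\phi:P^0\to\nabla A$ a bimodule map), and $\mathrm{HH}^1(\nabla A)$ has the following $\Bbbk$-basis. 1. $n=m=1$. - Case I: $[\sigma],\ [\tau_{x_2}],\ [\tau_{y_2}^{x}],\ [\beta\tau_{y_3}^{x}+\tau_{y_1}^{x}],\ [\tau_{x_2}^{y}],\ [\tau_{x_3}^{y}+\beta\tau_{x_1}^{y}]$. - Case II and Case 2: $[\sigma],\ [(\tfrac{\alpha}{2})^2\tau_{y_3}^{x}+\tfrac{\alpha}{2}\tau_{y_2}^{x}+\tau_{y_1}^{x}],\ [\tau_{x_3}^{y}+\tfrac{\alpha}{2}\tau_{x_2}^{y}+(\tfrac{\alpha}{2})^2\tau_{x_1}^{y}]$. - Case II and Case 3: $[\sigma]$. 2. $m>n=1$. - Case I: $[\sigma],\ [\delta],\ \Big[\sum_{r=2}^{m+2}\lambda_{r-1}\tau_{y_r}^{x^m}\Big],\ \Big[\beta\sum_{r=1}^{m+2}\lambda_{r-2}\tau_{y_r}^{x^m}\Big]$. - Case II and Case 1: $[\sigma],\ \Big[\sum_{r=2}^{m+2}\lambda_{r-1}\tau_{y_r}^{x^m}\Big],\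 \Big[\beta\sum_{r=1}^{m+2}\lambda_{r-2}\tau_{y_r}^{x^m}\Big]$. - Case II and Case 2: $[\sigma],\ \Big[\sum_{r=1}^{m+2}(\tfrac{\alpha}{2})^{r-1}\tau_{y_r}^{x^m}\Big]$. - Case II and Case 3: $[\sigma]$. 3. $m>n>1$. - Case I: $[\sigma],\ [\delta]$. - Case II: $[\sigma]$. -/

import Mathlib

open scoped TensorProduct DirectSum
open CategoryTheory

universe u

noncomputable section

/-! ### Bimodules, Hochschild cohomology, and classes of cocycles -/

namespace Hoch

/-- The enveloping algebra `B ⊗ Bᵐᵒᵖ`. A left module over it (equivalently a right module over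
`Bᵐᵒᵖ ⊗ B`) is a `B`-bimodule, with `(a ⊗ op b) • m = a m b`. -/
def Env (k B : Type u) [Field k] [Ring B] [Algebra k B] : Type u := B ⊗[k] Bᵐᵒᵖ

section General

variable (k : Type u) {B : Type u} [Field k] [Ring B] [Algebra k B]

instance : Ring (Env k B) := inferInstanceAs (Ring (B ⊗[k] Bᵐᵒᵖ))

instance : Algebra k (Env k B) := inferInstanceAs (Algebra k (B ⊗[k] Bᵐᵒᵖ))

/-- The bimodule `B`: `(a ⊗ op b) • c = a c b`. -/
instance bimodule : Module (Env k B) B :=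
  (TensorProduct.Algebra.module : Module (B ⊗[k] Bᵐᵒᵖ) B)

/-- The element `a ⊗ op b`, acting on bimodules as `m ↦ a m b`. -/
def act (a b : B) : Env k B := a ⊗ₜ[k] MulOpposite.op b

theorem act_smul (a b c : B) : act k a b • c = a * c * b :=
  (TensorProduct.Algebra.smul_def (R := k) a (MulOpposite.op b) c).trans (mul_assoc a c b).symm

theorem act_mul (a b c d : B) : act k a b * act k c d = act k (a * c) (d * b) :=
  Algebra.TensorProduct.tmul_mul_tmul _ _ _ _

theorem smul_act (r : k) (a b : B) : r • act k a b = act k (r • a) b :=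
  TensorProduct.smul_tmul' _ _ _

theorem env_induction {p : Env k B → Prop} (z : Env k B) (h0 : p 0) (h : ∀ a b, p (act k a b))
    (hadd : ∀ z w, p z → p w → p (z + w)) : p z :=
  TensorProduct.induction_on z h0 (fun a b => h a b.unop) hadd

instance bimodule_tower : IsScalarTower k (Env k B) B where
  smul_assoc r z c := by
    induction z using env_induction with
    | h0 => simp
    | h a b => simp [smul_act, act_smul]
    | hadd z w hz hw => rw [smul_add, add_smul, add_smul, smul_add, hz, hw]

/-- The category of bimodules is `k`-linear, through `k → B ⊗ Bᵐᵒᵖ`. -/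
instance bimodule_linear : Linear k (ModuleCat.{u} (Env k B)) := ModuleCat.Algebra.instLinear

variable (B) in
/-- Hochschild cohomology `HH^r(B) = Ext^r(B, B)` over the enveloping algebra, a `k`-space. -/
abbrev HH (r : ℕ) : Type u :=
  Abelian.Ext.{u} (ModuleCat.of (Env k B) B) (ModuleCat.of (Env k B) B) r

/-- The bimodule `B e ⊗ f B`, realised as the left ideal of `B ⊗ Bᵐᵒᵖ` generated by `e ⊗ op f`. -/
abbrev proj (e f : B) : Submodule (Env k B) (Env k B) :=
  Submodule.span (Env k B) {act k e f}

/-- The bimodule `⨁_h B s(h) ⊗ t(h) B`. -/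
def Free {ι : Type} (s t : ι → B) : Type u := ⨁ h : ι, proj k (s h) (t h)

instance {ι : Type} (s t : ι → B) : AddCommGroup (Free k s t) :=
  inferInstanceAs (AddCommGroup (⨁ h : ι, proj k (s h) (t h)))

instance {ι : Type} (s t : ι → B) : Module (Env k B) (Free k s t) :=
  inferInstanceAs (Module (Env k B) (⨁ h : ι, proj k (s h) (t h)))

/-- The generator `s(h) ⊗ t(h)` of the summand with index `h`. -/
def gen {ι : Type} [DecidableEq ι] (s t : ι → B) (h : ι) : Free k s t :=
  DirectSum.lof (Env k B) ι (fun h => proj k (s h) (t h)) h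
    ⟨act k (s h) (t h), Submodule.mem_span_singleton_self _⟩

/-- The bimodule map with `s(h) ⊗ t(h) ↦ v h`, for a family with `v h ∈ s(h) M t(h)`. -/
def ofGens {ι : Type} [DecidableEq ι] (s t : ι → B) {M : Type u} [AddCommGroup M]
    [Module (Env k B) M] (v : ι → M) : Free k s t →ₗ[Env k B] M :=
  DirectSum.toModule (Env k B) ι M fun h =>
    (LinearMap.toSpanSingleton (Env k B) M (v h)).comp (proj k (s h) (t h)).subtype

theorem ofGens_gen {ι : Type} [DecidableEq ι] (s t : ι → B) {M : Type u} [AddCommGroup M]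
    [Module (Env k B) M] (v : ι → M) (h : ι) :
    ofGens k s t v (gen k s t h) = act k (s h) (t h) • v h :=
  (DirectSum.toModule_lof (Env k B) h _).trans rfl

theorem hom_ext {ι : Type} [DecidableEq ι] {s t : ι → B} {M : Type u} [AddCommGroup M]
    [Module (Env k B) M] {f g : Free k s t →ₗ[Env k B] M}
    (hfg : ∀ h, f (gen k s t h) = g (gen k s t h)) : f = g := by
  refine DirectSum.linearMap_ext (Env k B) fun h => LinearMap.ext fun z => ?_
  obtain ⟨r, hr⟩ := Submodule.mem_span_singleton.1 z.2
  have hz : z = r • (⟨act k (s h) (t h), Submodule.mem_span_singleton_self _⟩ :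
      proj k (s h) (t h)) := Subtype.ext hr.symm
  rw [hz, map_smul, map_smul]
  exact congrArg (r • ·) (hfg h)

/-! For a quiver with vertices `V`, arrows `E`, source `s` and target `t`, with idempotents
`e : V → B` and elements `a : E → B`, the first terms of the bimodule complex of `B`. -/

section Complex

variable {V E : Type} [DecidableEq V] [DecidableEq E] (e : V → B) (a : E → B) (s t : E → V)

/-- `P⁰ = ⨁_i B e_i ⊗ e_i B`. -/
abbrev P0 : Type u := Free k e e

/-- `P¹ = ⨁_h B s(h) ⊗ t(h) B` over the arrows `h`. -/
abbrev P1 : Type u := Free k (fun h => e (s h)) (fun h => e (t h))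

/-- The multiplication map `∂⁰ : P⁰ → B`. -/
def d0 : P0 k e →ₗ[Env k B] B := ofGens k e e e

/-- `∂¹(s(h) ⊗ t(h)) = (s(h) ⊗ s(h)) h - h (t(h) ⊗ t(h))`. -/
def d1 : P1 k e s t →ₗ[Env k B] P0 k e :=
  ofGens k _ _ fun h => act k 1 (a h) • gen k e e (s h) - act k (a h) 1 • gen k e e (t h)

/-- The contribution of a path `p q r` of arrows to `∂²`:
`(s(p) ⊗ t(p)) q r + p (s(q) ⊗ t(q)) r + p q (s(r) ⊗ t(r))`. -/
def pathTerm (p q r : E) : P1 k e s t :=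
  act k 1 (a q * a r) • gen k (fun h => e (s h)) (fun h => e (t h)) p +
    act k (a p) (a r) • gen k (fun h => e (s h)) (fun h => e (t h)) q +
    act k (a p * a q) 1 • gen k (fun h => e (s h)) (fun h => e (t h)) r

/-- The cochain `P¹ → B` with `s(h) ⊗ t(h) ↦ b` for the given arrow `h` and zero on the other
generators, for `b ∈ s(h) B t(h)`. -/
def cochain (h : E) (b : B) : P1 k e s t →ₗ[Env k B] B :=
  ofGens k _ _ fun h' => if h' = h then b else 0

variable {e}

theorem d0_gen (he : ∀ i, e i * e i = e i) (i : V) : d0 k e (gen k e e i) = e i := by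
  rw [d0, ofGens_gen, act_smul, he, he]

theorem d0_surjective [Fintype V] (he : ∀ i, e i * e i = e i) (h1 : ∑ i, e i = 1) :
    Function.Surjective (d0 k e) := fun b =>
  ⟨∑ i, act k b 1 • gen k e e i, by
    simp only [map_sum, map_smul, d0_gen k he, act_smul, mul_one]
    rw [← Finset.mul_sum, h1, mul_one]⟩

variable {a s t}

theorem d0_d1 (he : ∀ i, e i * e i = e i) (hs : ∀ h, e (s h) * a h = a h)
    (ht : ∀ h, a h * e (t h) = a h) (p : P1 k e s t) :
    d1 k e a s t p ∈ LinearMap.ker (d0 k e) := by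
  have h0 : (d0 k e).comp (d1 k e a s t) = 0 := hom_ext k fun h => by
    rw [LinearMap.comp_apply, d1, ofGens_gen, map_smul, map_sub, map_smul, map_smul, d0_gen k he,
      d0_gen k he, act_smul k 1, act_smul k _ 1, one_mul, mul_one, hs, ht, sub_self, smul_zero,
      LinearMap.zero_apply]
  exact LinearMap.congr_fun h0 p

end Complex

end General

/-- For a surjection `ε : P → M` and a map `g : ker ε → N`, the image of `g` under the connecting
map `Hom(ker ε, N) → Ext¹(M, N)` of the short exact sequence `0 → ker ε → P → M → 0`. -/
def connecting {R : Type u} [Ring R] {P M N : Type u} [AddCommGroup P] [Module R P]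
    [AddCommGroup M] [Module R M] [AddCommGroup N] [Module R N]
    (ε : P →ₗ[R] M) (hε : Function.Surjective ε) (g : LinearMap.ker ε →ₗ[R] N) :
    Abelian.Ext.{u} (ModuleCat.of R M) (ModuleCat.of R N) 1 :=
  (LinearMap.shortExact_shortComplexKer hε).extClass.comp
    (Abelian.Ext.mk₀ (ModuleCat.ofHom g)) (add_zero 1)

end Hoch

/-! ### Down-up algebras and their Beilinson algebras -/

namespace DownUp

open Hoch

/-- The two generators. -/
inductive Letter
  | x
  | y

section Algebra

variable (k : Type u) [Field k]

/-- The generator of the free algebra named by a letter. -/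
def free (c : Letter) : FreeAlgebra k Letter := FreeAlgebra.ι k c

/-- The defining relations `x²y = β yx² + α xyx` and `xy² = β y²x + α yxy`. -/
inductive Rel (α β : k) : FreeAlgebra k Letter → FreeAlgebra k Letter → Prop
  | xxy : Rel α β (free k .x * free k .x * free k .y)
      (β • (free k .y * free k .x * free k .x) + α • (free k .x * free k .y * free k .x))
  | xyy : Rel α β (free k .x * free k .y * free k .y)
      (β • (free k .y * free k .y * free k .x) + α • (free k .y * free k .x * free k .y))

variable {k}

/-- The down-up algebra `A(α, β)`. -/
def A (α β : k) : Type u := RingQuot (Rel k α β)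

instance (α β : k) : Ring (A α β) := inferInstanceAs (Ring (RingQuot (Rel k α β)))

instance (α β : k) : Algebra k (A α β) := inferInstanceAs (Algebra k (RingQuot (Rel k α β)))

/-- The generator of `A(α, β)` named by a letter. -/
def letter (α β : k) (c : Letter) : A α β := RingQuot.mkAlgHom k (Rel k α β) (free k c)

/-- The weights: `deg x = n` and `deg y = m`. -/
def weight (n m : ℕ) : Letter → ℕ
  | .x => n
  | .y => m

/-- The homogeneous component `A_d`, spanned by the words of weight `d`. -/
def comp (n m : ℕ) (α β : k) (d : ℕ) : Submodule k (A α β) :=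
  Submodule.span k {a | ∃ w : List Letter,
    (w.map (weight n m)).sum = d ∧ a = (w.map (letter α β)).prod}

theorem letter_mem (n m : ℕ) (α β : k) (c : Letter) :
    letter α β c ∈ comp n m α β (weight n m c) :=
  Submodule.subset_span ⟨[c], by simp, by simp⟩

theorem one_mem_comp (n m : ℕ) (α β : k) : (1 : A α β) ∈ comp n m α β 0 :=
  Submodule.subset_span ⟨[], by simp, by simp⟩

theorem mul_mem_comp {n m : ℕ} {α β : k} {c d : ℕ} {a b : A α β}
    (ha : a ∈ comp n m α β c) (hb : b ∈ comp n m α β d) : a * b ∈ comp n m α β (c + d) := by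
  have h := Submodule.mul_mem_mul ha hb
  rw [comp, comp, Submodule.span_mul_span] at h
  refine Submodule.span_mono ?_ h
  rintro _ ⟨_, ⟨w, hw, rfl⟩, _, ⟨w', hw', rfl⟩, rfl⟩
  exact ⟨w ++ w', by simp [hw, hw'], by simp⟩

theorem pow_mem_comp (n m : ℕ) (α β : k) (r : ℕ) :
    letter α β .x ^ r ∈ comp n m α β (r * n) :=
  Submodule.subset_span ⟨List.replicate r .x, by simp [weight], by simp⟩

/-- The space of allowed `(i, j)` entries: `A_{j-i}` for `i ≤ j`, and zero below the diagonal. -/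
def entry (n m : ℕ) (α β : k) (i j : ℕ) : Submodule k (A α β) :=
  if i ≤ j then comp n m α β (j - i) else ⊥

theorem mul_mem_entry {n m : ℕ} {α β : k} {i j l : ℕ} {a b : A α β}
    (ha : a ∈ entry n m α β i j) (hb : b ∈ entry n m α β j l) : a * b ∈ entry n m α β i l := by
  unfold entry at *
  split_ifs at ha with h1
  · split_ifs at hb with h2
    · rw [if_pos (h1.trans h2)]
      have h := mul_mem_comp ha hb
      rwa [show j - i + (l - j) = l - i by omega] at h
    · rw [(Submodule.mem_bot k).1 hb, mul_zero]
      exact zero_mem _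
  · rw [(Submodule.mem_bot k).1 ha, zero_mul]
    exact zero_mem _

theorem one_mem_entry (n m : ℕ) (α β : k) (i : ℕ) : (1 : A α β) ∈ entry n m α β i i := by
  rw [entry, if_pos le_rfl, Nat.sub_self]
  exact one_mem_comp n m α β

/-- The Beilinson algebra `∇A`: upper triangular matrices of size `ℓ = 2(n+m)` whose `(i, j)` entry
lies in `A_{j-i}`, with the usual matrix product. (With the product `(∑ r, a r j * b i r)` one gets
an isomorphic algebra: send position `(i, j)` to position `(ℓ+1-j, ℓ+1-i)`.) -/
def beilinson (n m : ℕ) (α β : k) :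
    Subalgebra k (Matrix (Fin (2 * (n + m))) (Fin (2 * (n + m))) (A α β)) where
  carrier := {M | ∀ i j : Fin (2 * (n + m)), M i j ∈ entry n m α β i j}
  mul_mem' hM hN i j := by
    rw [Matrix.mul_apply]
    exact sum_mem fun l _ => mul_mem_entry (hM i l) (hN l j)
  add_mem' hM hN i j := add_mem (hM i j) (hN i j)
  algebraMap_mem' r i j := by
    rw [Matrix.algebraMap_matrix_apply]
    split_ifs with h
    · subst h
      rw [Algebra.algebraMap_eq_smul_one]
      exact Submodule.smul_mem _ _ (one_mem_entry n m α β i)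
    · exact zero_mem _

/-- The Beilinson algebra as a type. -/
def NablaA (n m : ℕ) (α β : k) : Type u := beilinson n m α β

instance (n m : ℕ) (α β : k) : Ring (NablaA n m α β) := inferInstanceAs (Ring (beilinson n m α β))

instance (n m : ℕ) (α β : k) : Algebra k (NablaA n m α β) :=
  inferInstanceAs (Algebra k (beilinson n m α β))

/-- The element of `∇A` with the only entry `a ∈ A_d`, at position `(i, j)`, where `j = i + d`. -/
def elt {n m : ℕ} {α β : k} (i j : Fin (2 * (n + m))) {d : ℕ} (hd : (j : ℕ) = i + d) (a : A α β)
    (ha : a ∈ comp n m α β d) : NablaA n m α β :=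
  ⟨Matrix.single i j a, fun i' j' => by
    rw [Matrix.single_apply]
    split_ifs with h
    · rw [← h.1, ← h.2, entry, if_pos (by omega), hd, Nat.add_sub_cancel_left]
      exact ha
    · exact zero_mem _⟩

end Algebra

/-! ### The quiver -/

section Quiver

/-- The arrows: `x_i` for `n + 2m` values of `i`, and `y_j` for `2n + m` values of `j`.
All indices of vertices, arrows and relations start at `0`. -/
abbrev Arrow (n m : ℕ) : Type := Fin (n + 2 * m) ⊕ Fin (2 * n + m)

variable {n m : ℕ}

/-- The arrow `x_i`. -/
def ax (i : ℕ) (h : i < n + 2 * m) : Arrow n m := .inl ⟨i, h⟩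

/-- The arrow `y_j`. -/
def ay (j : ℕ) (h : j < 2 * n + m) : Arrow n m := .inr ⟨j, h⟩

/-- The source of an arrow. -/
def src : Arrow n m → Fin (2 * (n + m))
  | .inl i => ⟨i, by omega⟩
  | .inr j => ⟨j, by omega⟩

/-- The letter naming an arrow. -/
def lab : Arrow n m → Letter
  | .inl _ => .x
  | .inr _ => .y

/-- The target of an arrow: `x_i : i → i + n` and `y_j : j → j + m`. -/
def tgt : Arrow n m → Fin (2 * (n + m))
  | .inl i => ⟨i + n, by omega⟩
  | .inr j => ⟨j + m, by omega⟩

theorem tgt_eq (h : Arrow n m) : (tgt h : ℕ) = src h + weight n m (lab h) := by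
  rcases h with i | j <;> rfl

/-- The relations: `f_i` for `m` values of `i`, and `g_j` for `n` values of `j`. -/
abbrev Reln (n m : ℕ) : Type := Fin m ⊕ Fin n

/-- The source of a relation. -/
def rsrc : Reln n m → Fin (2 * (n + m))
  | .inl i => ⟨i, by omega⟩
  | .inr j => ⟨j, by omega⟩

/-- The target of a relation: `f_i : i → i + 2n + m` and `g_j : j → j + n + 2m`. -/
def rtgt : Reln n m → Fin (2 * (n + m))
  | .inl i => ⟨i + 2 * n + m, by omega⟩
  | .inr j => ⟨j + n + 2 * m, by omega⟩

variable {k : Type u} [Field k] {α β : k}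

/-- The idempotent of a vertex. -/
def idem (n m : ℕ) (α β : k) (i : Fin (2 * (n + m))) : NablaA n m α β :=
  elt i i (d := 0) rfl 1 (one_mem_comp n m α β)

/-- The element of `∇A` of an arrow. -/
def arr (α β : k) (h : Arrow n m) : NablaA n m α β :=
  elt (src h) (tgt h) (tgt_eq h) (letter α β (lab h)) (letter_mem n m α β (lab h))

theorem idem_mul_elt (i j : Fin (2 * (n + m))) {d : ℕ} (hd : (j : ℕ) = i + d) (a : A α β)
    (ha : a ∈ comp n m α β d) : idem n m α β i * elt i j hd a ha = elt i j hd a ha :=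
  Subtype.ext ((Matrix.single_mul_single_same _ _ _ _ _).trans (by rw [one_mul]; rfl))

theorem elt_mul_idem (i j : Fin (2 * (n + m))) {d : ℕ} (hd : (j : ℕ) = i + d) (a : A α β)
    (ha : a ∈ comp n m α β d) : elt i j hd a ha * idem n m α β j = elt i j hd a ha :=
  Subtype.ext ((Matrix.single_mul_single_same _ _ _ _ _).trans (by rw [mul_one]; rfl))

theorem sum_idem : ∑ i, idem n m α β i = 1 := by
  refine Subtype.ext ((map_sum (beilinson n m α β).val _ _).trans ?_)
  change ∑ i, Matrix.single i i (1 : A α β) = 1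
  ext i j
  simp [Matrix.sum_apply, Matrix.single_apply, Matrix.one_apply, ite_and]

end Quiver

/-! ### The bimodule complex and the cochains -/

section Resolution

variable {k : Type u} [Field k] (n m : ℕ) (α β : k)

/-- `P¹` for `∇A`. -/
abbrev Q1 : Type u := P1 k (idem n m α β) (src (n := n) (m := m)) tgt

/-- `P² = ⨁_h ∇A s(h) ⊗ t(h) ∇A` over the relations `h`. -/
abbrev Q2 : Type u :=
  Free k (fun h : Reln n m => idem n m α β (rsrc h)) (fun h => idem n m α β (rtgt h))

/-- The map `∂⁰` for `∇A`. -/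
abbrev D0 : P0 k (idem n m α β) →ₗ[Env k (NablaA n m α β)] NablaA n m α β := d0 k (idem n m α β)

/-- The map `∂¹` for `∇A`. -/
abbrev D1 : Q1 n m α β →ₗ[Env k (NablaA n m α β)] P0 k (idem n m α β) :=
  d1 k (idem n m α β) (arr α β) src tgt

variable {n m} in
/-- The contribution of a path of three arrows to `∂²`. -/
abbrev path (p q r : Arrow n m) : Q1 n m α β :=
  pathTerm k (idem n m α β) (arr α β) src tgt p q r

/-- The value of `∂²` on the generator of a relation, where
`f_i = x_i x_{i+n} y_{i+2n} - α x_i y_{i+n} x_{i+n+m} - β y_i x_{i+m} x_{i+n+m}` and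
`g_j = x_j y_{j+n} y_{j+n+m} - α y_j x_{j+m} y_{j+n+m} - β y_j y_{j+m} x_{j+2m}`. -/
def relTerm : Reln n m → Q1 n m α β
  | .inl i =>
    path α β (ax i (by omega)) (ax (i + n) (by omega)) (ay (i + 2 * n) (by omega))
    - algebraMap k (Env k (NablaA n m α β)) α •
      path α β (ax i (by omega)) (ay (i + n) (by omega)) (ax (i + n + m) (by omega))
    - algebraMap k (Env k (NablaA n m α β)) β •
      path α β (ay i (by omega)) (ax (i + m) (by omega)) (ax (i + n + m) (by omega))
  | .inr j =>
    path α β (ax j (by omega)) (ay (j + n) (by omega)) (ay (j + n + m) (by omega))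
    - algebraMap k (Env k (NablaA n m α β)) α •
      path α β (ay j (by omega)) (ax (j + m) (by omega)) (ay (j + n + m) (by omega))
    - algebraMap k (Env k (NablaA n m α β)) β •
      path α β (ay j (by omega)) (ay (j + m) (by omega)) (ax (j + 2 * m) (by omega))

/-- The map `∂²` for `∇A`. -/
def D2 : Q2 n m α β →ₗ[Env k (NablaA n m α β)] Q1 n m α β :=
  ofGens k _ _ (relTerm n m α β)

theorem D0_surjective : Function.Surjective (D0 n m α β) :=
  d0_surjective k (fun i => idem_mul_elt i i rfl _ _) sum_idem

theorem D0_D1 (p : Q1 n m α β) : D1 n m α β p ∈ LinearMap.ker (D0 n m α β) :=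
  d0_d1 k (fun i => idem_mul_elt i i rfl _ _) (fun _ => idem_mul_elt _ _ _ _ _)
    (fun _ => elt_mul_idem _ _ _ _ _) p

/-- One-cochains: bimodule maps `P¹ → ∇A`. -/
abbrev Cochain : Type u := Q1 n m α β →ₗ[Env k (NablaA n m α β)] NablaA n m α β

variable {n m α β}

/-- `c = [f]`: the cochain `f` is a cocycle (`f ∘ ∂² = 0`) and `c ∈ HH¹(∇A) = Ext¹(∇A, ∇A)` is its
class. That is, `f` factors as `g ∘ ∂¹` through the syzygy `ker ∂⁰ = im ∂¹`, and `c` is the image of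
`g` under the connecting map of `0 → ker ∂⁰ → P⁰ → ∇A → 0`. -/
def IsClass (f : Cochain n m α β) (c : HH k (NablaA n m α β) 1) : Prop :=
  f ∘ₗ D2 n m α β = 0 ∧
    ∃ g : LinearMap.ker (D0 n m α β) →ₗ[Env k (NablaA n m α β)] NablaA n m α β,
      (∀ p, g ⟨D1 n m α β p, D0_D1 n m α β p⟩ = f p) ∧
      c = connecting (D0 n m α β) (D0_surjective n m α β) g

variable (n m α β)

/-- The classes of the listed cochains form a `k`-basis of `HH¹(∇A)`. -/
def IsHHBasis {N : ℕ} (f : Fin N → Cochain n m α β) : Prop :=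
  ∃ b : Module.Basis (Fin N) k (HH k (NablaA n m α β) 1), ∀ i, IsClass (f i) (b i)

/-- The cochain `f` is a coboundary `φ ∘ ∂¹`. -/
def IsCoboundary (f : Cochain n m α β) : Prop :=
  ∃ φ : P0 k (idem n m α β) →ₗ[Env k (NablaA n m α β)] NablaA n m α β, f = φ ∘ₗ D1 n m α β

variable {n m}

/-- The cochain sending the generator of the arrow `h` to the element `a ∈ A_d` in position
`(s(h), t(h))`, where `d` is the weight of the letter of `h`, and the other generators to zero. -/
def tau (h : Arrow n m) (a : A α β) (ha : a ∈ comp n m α β (weight n m (lab h))) :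
    Cochain n m α β :=
  cochain k (idem n m α β) src tgt h (elt (src h) (tgt h) (tgt_eq h) a ha)

/-- `τ_{x_i}`. -/
def tauX (i : Fin (n + 2 * m)) : Cochain n m α β :=
  tau α β (.inl i) (letter α β .x) (letter_mem n m α β .x)

/-- `τ_{y_j}`. -/
def tauY (j : Fin (2 * n + m)) : Cochain n m α β :=
  tau α β (.inr j) (letter α β .y) (letter_mem n m α β .y)

/-- `τ_{y_j}^{x^m}`, for `n = 1`: the generator of `y_j` goes to `x_j x_{j+1} ⋯ x_{j+m-1}`. -/
def tauYX (hn : n = 1) (j : Fin (2 * n + m)) : Cochain n m α β :=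
  tau α β (.inr j) (letter α β .x ^ m) (by
    have h := pow_mem_comp n m α β m
    rwa [show m * n = m by rw [hn, mul_one]] at h)

/-- `τ_{x_i}^y`, for `n = m = 1`: the generator of `x_i` goes to `y_i`. -/
def tauXY (hn : n = 1) (hm : m = 1) (i : Fin (n + 2 * m)) : Cochain n m α β :=
  tau α β (.inl i) (letter α β .y) (by
    have h := letter_mem n m α β .y
    rwa [show weight n m .y = weight n m .x by rw [weight, weight, hn, hm]] at h)

/-- The sequence with `λ_{-1} = β⁻¹`, `λ_0 = 0`, `λ_{r+2} = α λ_{r+1} + β λ_r`, shifted by one: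
`lam α β r` is `λ_{r-1}`. -/
def lam : ℕ → k
  | 0 => β⁻¹
  | 1 => 0
  | r + 2 => α * lam (r + 1) + β * lam r

variable (n m)

/-- Case I (its negation is Case II). -/
def CaseI : Prop := Even (n + m) ∧ α = 0

/-- Case 1: `λ_{m+1} = 0`. -/
def Case1 : Prop := lam α β (m + 2) = 0

/-- Case 2: `λ_{m+1} ≠ 0` and `α² + 4β = 0`. -/
def Case2 : Prop := lam α β (m + 2) ≠ 0 ∧ α ^ 2 + 4 * β = 0

/-- Case 3: `λ_{m+1} ≠ 0` and `α² + 4β ≠ 0`. -/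
def Case3 : Prop := lam α β (m + 2) ≠ 0 ∧ α ^ 2 + 4 * β ≠ 0

variable {n m}

/-- `∑_r τ_{x_r}` over all the arrows `x_r`. -/
def sumX : Cochain n m α β := ∑ i : Fin (n + 2 * m), tauX α β i

/-- `∑_{r=1}^m (-1)^{r-1} τ_{x_{n+r}}` (numbering from `1`). -/
def altX : Cochain n m α β :=
  ∑ r : Fin m, (-1 : k) ^ (r : ℕ) • tauX α β ⟨n + r, by omega⟩

end Resolution
end DownUp

end

/-! Write B = ∇A. Since P⁰ is projective, HH¹(B) is the cokernel of Hom(P⁰, B) → Hom(ker ∂⁰, B)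
(`connecting_surjective`, `connecting_eq_zero_iff`), and ker ∂⁰ = im ∂¹ because vertices and arrows
generate B (`ker_d0_le_range_d1`). It remains to see that every f with f∂² = 0 factors through im
∂¹. Exactness at P¹ is not used for this. The values of f on the arrows deform the letters into
matrices over the dual numbers of A that still satisfy the down-up relations; the resulting algebra
homomorphism gives a derivation D of B that kills the vertices (`exists_derivation`), and ∑ b ⊗ c ↦
∑ b D(c) is the required map on ker ∂⁰ (`exists_syzygy_map`). Hence HH¹ is cocycles modulo
coboundaries (`isHHBasis_of`).

By degree, a cochain amounts to scalar sequences: the coefficients a of x and a' of y on the x_i,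
and b of y and b' of x^m on the y_j. Here a' occurs only for n = m = 1 and b' only for n = 1. A
coboundary is given by one scalar per vertex and affects only a and b. Expanding the relations in
words whose independence is seen in two shift representations splits the cocycle condition into
three blocks (`compatible_iff`).

Diagonal block (a, b): a 1-cochain on the quiver, with a curvature on each square i, i+n, i+m,
i+n+m. Being a cocycle means that α kills the curvature and that the curvature changes sign under i
↦ i + n on ℤ/(n+m). By coprimality this translation is a single cycle, so the curvature vanishes if
α ≠ 0 or n + m is odd; in Case I it is a multiple of (-1)^i, which δ realises. A flat cochain is
determined modulo coboundaries by its holonomy around the cycle on the first n + m vertices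
(`diagBoundary_of_curv_eq_zero`), and σ has holonomy m ≠ 0.

Block y ↦ x^m: b' solves the recursion of λ, hence depends on b'₀ and b'₁, subject to λ_{m+1} times
a 2 × 2 system of determinant α² + 4β (`yxCocycle_iff`). This gives dimension 2, 1, 0 in Cases 1, 2,
3. Block x ↦ y for n = m = 1: one equation on three unknowns if α = 0, and otherwise a system that
has a nonzero solution exactly when α² + 4β = 0 (`xyCocycle_one_one_iff`). -/

noncomputable section

/-! ### The connecting map onto Ext¹, and projectivity of the terms -/

namespace Hoch

section Connecting

variable {R : Type u} [Ring R] {P M N : Type u} [AddCommGroup P] [Module R P]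
  [AddCommGroup M] [Module R M] [AddCommGroup N] [Module R N]
  (ε : P →ₗ[R] M) (hε : Function.Surjective ε)

theorem connecting_add (g h : LinearMap.ker ε →ₗ[R] N) :
    connecting ε hε (g + h) = connecting ε hε g + connecting ε hε h := by
  rw [connecting, connecting, connecting, ModuleCat.ofHom_add, Abelian.Ext.mk₀_add,
    Abelian.Ext.comp_add]

/-- Exactness of Hom(P, N) → Hom(ker ε, N) → Ext¹(M, N) at the middle term. -/
theorem connecting_eq_zero_iff (g : LinearMap.ker ε →ₗ[R] N) :
    connecting ε hε g = 0 ↔ ∃ φ : P →ₗ[R] N, φ ∘ₗ (LinearMap.ker ε).subtype = g := by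
  constructor
  · intro h
    obtain ⟨y, hy⟩ := Abelian.Ext.contravariant_sequence_exact₁
      (LinearMap.shortExact_shortComplexKer hε) (Y := ModuleCat.of R N) _ _ h
    obtain ⟨φ, rfl⟩ := Abelian.Ext.addEquiv₀.symm.surjective y
    rw [Abelian.Ext.addEquiv₀_symm_apply, Abelian.Ext.mk₀_comp_mk₀] at hy
    have h2 := congrArg ModuleCat.Hom.hom (Abelian.Ext.addEquiv₀.symm.injective hy)
    exact ⟨φ.hom, h2⟩
  · rintro ⟨φ, rfl⟩
    have h : ModuleCat.ofHom (φ ∘ₗ (LinearMap.ker ε).subtype)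
        = (LinearMap.shortComplexKer ε).f ≫ ModuleCat.ofHom φ := rfl
    rw [connecting, h, ← Abelian.Ext.mk₀_comp_mk₀]
    exact ShortComplex.ShortExact.extClass_comp_assoc _ _

/-- The next term of the long exact sequence is Ext¹(P, N), which vanishes for projective P. -/
theorem connecting_surjective [Module.Projective R P] :
    Function.Surjective (connecting (N := N) ε hε) := fun c => by
  have : Projective (LinearMap.shortComplexKer ε).X₂ :=
    (IsProjective.iff_projective P).1 inferInstance
  obtain ⟨x, hx⟩ := Abelian.Ext.contravariant_sequence_exact₃
    (LinearMap.shortExact_shortComplexKer hε) (Y := ModuleCat.of R N) c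
    (Abelian.Ext.eq_zero_of_projective _) (add_zero 1)
  obtain ⟨φ, rfl⟩ := Abelian.Ext.addEquiv₀.symm.surjective x
  exact ⟨φ.hom, hx⟩

end Connecting

variable {k B : Type u} [Field k] [Ring B] [Algebra k B]

theorem connecting_smul {P : Type u} [AddCommGroup P] [Module (Env k B) P]
    (ε : P →ₗ[Env k B] B) (hε : Function.Surjective ε) (r : k)
    (g : LinearMap.ker ε →ₗ[Env k B] B) :
    (connecting ε hε (r • g) : HH k B 1) = r • (connecting ε hε g : HH k B 1) := by
  rw [connecting, connecting, ← Abelian.Ext.comp_smul, ← Abelian.Ext.mk₀_smul]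
  congr 2
  ext x
  -- Two actions of k meet here: the pointwise one on linear maps, and the one on the category of
  -- bimodules through k → B ⊗ Bᵐᵒᵖ.
  change r • g x = algebraMap k (Env k B) r • g x
  rw [algebraMap_smul]

/-- The connecting map from cochains on the syzygy to `HH¹`, as a `k`-linear map. -/
def connectingHom {P : Type u} [AddCommGroup P] [Module (Env k B) P]
    (ε : P →ₗ[Env k B] B) (hε : Function.Surjective ε) :
    (LinearMap.ker ε →ₗ[Env k B] B) →ₗ[k] HH k B 1 where
  toFun := connecting ε hε
  map_add' := connecting_add ε hε
  map_smul' := connecting_smul ε hε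

/-- As e ⊗ f is idempotent, right multiplication by it retracts the enveloping algebra onto this
left ideal. -/
theorem projective_proj {e f : B} (he : e * e = e) (hf : f * f = f) :
    Module.Projective (Env k B) (proj k e f) := by
  refine Module.Projective.of_split (proj k e f).subtype
    (LinearMap.toSpanSingleton (Env k B) (proj k e f)
      ⟨act k e f, Submodule.mem_span_singleton_self _⟩) (LinearMap.ext fun z => Subtype.ext ?_)
  obtain ⟨r, hr⟩ := Submodule.mem_span_singleton.1 z.2
  change (z : Env k B) * act k e f = z
  rw [← hr, smul_eq_mul, mul_assoc, act_mul, he, hf]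

theorem projective_free {ι : Type} {s t : ι → B} (hs : ∀ h, s h * s h = s h)
    (ht : ∀ h, t h * t h = t h) : Module.Projective (Env k B) (Free k s t) := by
  have := fun h => projective_proj (k := k) (hs h) (ht h)
  exact inferInstanceAs (Module.Projective (Env k B) (⨁ h : ι, proj k (s h) (t h)))

end Hoch

/-! ### Exactness at P⁰, and derivations as maps on the syzygy -/

namespace Hoch

variable {k B : Type u} [Field k] [Ring B] [Algebra k B]

/-- Serves as induction on generators: a property closed under the bimodule operations holds
everywhere once it holds on each `gen`. -/
theorem free_submodule_eq_top {ι : Type} [DecidableEq ι] {s t : ι → B}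
    (p : Submodule (Env k B) (Free k s t)) (h : ∀ i, gen k s t i ∈ p) : p = ⊤ := by
  have h0 : p.mkQ = 0 := hom_ext k fun i => by simpa using h i
  rw [← p.ker_mkQ, h0, LinearMap.ker_zero]

theorem smul_gen {ι : Type} [DecidableEq ι] {s t : ι → B} (r : Env k B) (h : ι) :
    r • gen k s t h = DirectSum.lof (Env k B) ι (fun h => proj k (s h) (t h)) h
      (r • ⟨act k (s h) (t h), Submodule.mem_span_singleton_self _⟩) :=
  (map_smul (DirectSum.lof (Env k B) ι (fun h => proj k (s h) (t h)) h) r _).symm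

theorem act_smul_gen {ι : Type} [DecidableEq ι] {s t : ι → B} (hs : ∀ h, s h * s h = s h)
    (ht : ∀ h, t h * t h = t h) (h : ι) : act k (s h) (t h) • gen k s t h = gen k s t h := by
  refine (smul_gen _ _).trans (congrArg (DirectSum.lof (Env k B) ι
    (fun h => proj k (s h) (t h)) h) (Subtype.ext ?_))
  change act k (s h) (t h) * act k (s h) (t h) = act k (s h) (t h)
  rw [act_mul, hs, ht]

theorem act_zero_left (b : B) : act k 0 b = 0 := TensorProduct.zero_tmul _ _

theorem act_zero_right (b : B) : act k b 0 = 0 := TensorProduct.tmul_zero _ _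

theorem act_add_left (b c d : B) : act k (b + c) d = act k b d + act k c d :=
  TensorProduct.add_tmul _ _ _

theorem act_add_right (b c d : B) : act k d (b + c) = act k d b + act k d c :=
  TensorProduct.tmul_add _ _ _

theorem act_smul_right (r : k) (b c : B) : act k b (r • c) = r • act k b c :=
  TensorProduct.tmul_smul (R := k) r b (MulOpposite.op c)

theorem act_algebraMap (r : k) : act k 1 (algebraMap k B r) = act k (algebraMap k B r) 1 := by
  rw [Algebra.algebraMap_eq_smul_one, ← smul_act, act_smul_right]

section Complex

variable {V E : Type} [DecidableEq V] [DecidableEq E] {e : V → B} {a : E → B} {s t : E → V}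

theorem d1_gen (he : ∀ i, e i * e i = e i) (hs : ∀ h, e (s h) * a h = a h)
    (ht : ∀ h, a h * e (t h) = a h) (h : E) :
    d1 k e a s t (gen k _ _ h) =
      act k 1 (a h) • gen k e e (s h) - act k (a h) 1 • gen k e e (t h) := by
  rw [d1, ofGens_gen, smul_sub, ← mul_smul, ← mul_smul, act_mul, act_mul, mul_one, hs, one_mul, ht,
    ← act_smul_gen (k := k) he he (s h), ← act_smul_gen (k := k) he he (t h)]
  simp only [← mul_smul, act_mul, he, mul_one, one_mul, hs, ht]

/-- The sum telescopes: the inner terms cancel at the two intermediate vertices, so only the product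
of the path remains. -/
theorem d1_pathTerm (he : ∀ i, e i * e i = e i) (hs : ∀ h, e (s h) * a h = a h)
    (ht : ∀ h, a h * e (t h) = a h) {p q r : E} (hpq : t p = s q) (hqr : t q = s r) :
    d1 k e a s t (pathTerm k e a s t p q r) =
      act k 1 (a p * a q * a r) • gen k e e (s p) -
        act k (a p * a q * a r) 1 • gen k e e (t r) := by
  simp only [pathTerm, map_add, map_smul, d1_gen he hs ht, smul_sub, ← mul_smul, act_mul, mul_one,
    one_mul, hpq, hqr]
  rw [mul_assoc]
  abel

-- The Leibniz rule: on paths a cochain behaves as a derivation, so f∂² = 0 says that this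
-- derivation respects the relations.
omit [DecidableEq V] in
theorem map_pathTerm (f : P1 k e s t →ₗ[Env k B] B) (p q r : E) :
    f (pathTerm k e a s t p q r) =
      f (gen k _ _ p) * a q * a r + a p * f (gen k _ _ q) * a r + a p * a q * f (gen k _ _ r) := by
  simp only [pathTerm, map_add, map_smul, act_smul, one_mul, mul_one, mul_assoc]

omit [DecidableEq V] in
theorem map_gen_eq (he : ∀ i, e i * e i = e i) (f : P1 k e s t →ₗ[Env k B] B) (h : E) :
    e (s h) * f (gen k _ _ h) * e (t h) = f (gen k _ _ h) := by
  rw [← act_smul (k := k), ← map_smul, act_smul_gen (s := fun h => e (s h)) (t := fun h => e (t h))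
    (fun h => he (s h)) (fun h => he (t h))]

/-- If the vertices and arrows generate `B` as an algebra, then `∂¹` maps onto `ker ∂⁰`. -/
theorem ker_d0_le_range_d1 [Fintype V] (he : ∀ i, e i * e i = e i)
    (horth : ∀ i j, i ≠ j → e i * e j = 0)
    (hs : ∀ h, e (s h) * a h = a h) (ht : ∀ h, a h * e (t h) = a h)
    (hgen : ∀ S : Subalgebra k B, (∀ i, e i ∈ S) → (∀ h, a h ∈ S) → S = ⊤) :
    LinearMap.ker (d0 k e) ≤ LinearMap.range (d1 k e a s t) := by
  set Z := LinearMap.range (d1 k e a s t)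
  -- The aim is that every z is congruent to ∂⁰(z)γ modulo the image Z of ∂¹, so that z ∈ Z when
  -- ∂⁰(z) = 0. This follows once γ is central modulo Z.
  set γ := ∑ i, gen k e e i with hγ
  have hleft (b : B) (j : V) : act k (b * e j) 1 • γ = act k b 1 • gen k e e j := by
    rw [hγ, Finset.smul_sum, Finset.sum_eq_single j]
    · rw [← act_smul_gen (k := k) he he j, ← mul_smul, ← mul_smul, act_mul, act_mul, mul_assoc, he]
    · intro i _ hij
      rw [← act_smul_gen (k := k) he he i, ← mul_smul, act_mul, mul_assoc, horth j i hij.symm,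
        mul_zero, act_zero_left, zero_smul]
    · simp
  have hright (b : B) (j : V) : act k 1 (e j * b) • γ = act k 1 b • gen k e e j := by
    rw [hγ, Finset.smul_sum, Finset.sum_eq_single j]
    · rw [← act_smul_gen (k := k) he he j, ← mul_smul, ← mul_smul, act_mul, act_mul, ← mul_assoc,
        he]
    · intro i _ hij
      rw [← act_smul_gen (k := k) he he i, ← mul_smul, act_mul, ← mul_assoc, horth i j hij,
        zero_mul, act_zero_right, zero_smul]
    · simp
  -- The elements that commute with γ modulo Z. Vertices commute with γ exactly, and for an arrow
  -- the commutator is ∂¹ of its generator.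
  let S : Subalgebra k B :=
    { carrier := {b | act k 1 b • γ - act k b 1 • γ ∈ Z}
      mul_mem' := fun {b c} hb hc => by
        have h : act k 1 (b * c) • γ - act k (b * c) 1 • γ =
            act k 1 c • (act k 1 b • γ - act k b 1 • γ) +
              act k b 1 • (act k 1 c • γ - act k c 1 • γ) := by
          simp only [smul_sub, ← mul_smul, act_mul, one_mul, mul_one]
          abel
        rw [Set.mem_ofPred_eq, h]
        exact Z.add_mem (Z.smul_mem _ hb) (Z.smul_mem _ hc)
      add_mem' := fun {b c} hb hc => by
        have h : act k 1 (b + c) • γ - act k (b + c) 1 • γ =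
            (act k 1 b • γ - act k b 1 • γ) + (act k 1 c • γ - act k c 1 • γ) := by
          rw [act_add_left, act_add_right, add_smul, add_smul]
          abel
        rw [Set.mem_ofPred_eq, h]
        exact Z.add_mem hb hc
      algebraMap_mem' := fun r => by
        rw [Set.mem_ofPred_eq, act_algebraMap, sub_self]
        exact Z.zero_mem }
  have hS : S = ⊤ := hgen S
    (fun i => by
      change act k 1 (e i) • γ - act k (e i) 1 • γ ∈ Z
      have h := hright 1 i
      have h' := hleft 1 i
      rw [mul_one] at h
      rw [one_mul] at h'
      rw [h, h', sub_self]
      exact Z.zero_mem)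
    (fun h => by
      change act k 1 (a h) • γ - act k (a h) 1 • γ ∈ Z
      have h1 := hright (a h) (s h)
      have h2 := hleft (a h) (t h)
      rw [hs] at h1
      rw [ht] at h2
      rw [h1, h2, ← d1_gen he hs ht]
      exact LinearMap.mem_range_self _ _)
  have hcomm (b : B) : act k 1 b • γ - act k b 1 • γ ∈ Z := by
    have : b ∈ S := hS ▸ Algebra.mem_top
    exact this
  -- Closure under the right action is where centrality of γ modulo Z enters.
  let T : Submodule (Env k B) (P0 k e) :=
    { carrier := {z | z - act k (d0 k e z) 1 • γ ∈ Z}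
      add_mem' := fun {z w} hz hw => by
        have h : z + w - act k (d0 k e (z + w)) 1 • γ =
            (z - act k (d0 k e z) 1 • γ) + (w - act k (d0 k e w) 1 • γ) := by
          rw [map_add, act_add_left, add_smul]
          abel
        rw [Set.mem_ofPred_eq, h]
        exact Z.add_mem hz hw
      zero_mem' := by
        rw [Set.mem_ofPred_eq, map_zero, act_zero_left, zero_smul, sub_zero]
        exact Z.zero_mem
      smul_mem' := fun r z hz => by
        induction r using env_induction with
        | h0 =>
          rw [zero_smul, Set.mem_ofPred_eq, map_zero, act_zero_left, zero_smul, sub_zero]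
          exact Z.zero_mem
        | h b c =>
          have h : act k b c • z - act k (d0 k e (act k b c • z)) 1 • γ =
              act k b c • (z - act k (d0 k e z) 1 • γ) +
                act k (b * d0 k e z) 1 • (act k 1 c • γ - act k c 1 • γ) := by
            rw [map_smul, act_smul]
            simp only [smul_sub, ← mul_smul, act_mul, one_mul, mul_one]
            abel
          rw [Set.mem_ofPred_eq, h]
          exact Z.add_mem (Z.smul_mem _ hz) (Z.smul_mem _ (hcomm c))
        | hadd r r' hr hr' =>
          have h : (r + r') • z - act k (d0 k e ((r + r') • z)) 1 • γ =
              (r • z - act k (d0 k e (r • z)) 1 • γ) +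
                (r' • z - act k (d0 k e (r' • z)) 1 • γ) := by
            rw [add_smul, map_add, act_add_left, add_smul]
            abel
          rw [Set.mem_ofPred_eq, h]
          exact Z.add_mem hr hr' }
  have hT : T = ⊤ := free_submodule_eq_top T fun i => by
    change gen k e e i - act k (d0 k e (gen k e e i)) 1 • γ ∈ Z
    have h := hleft (e i) i
    rw [he] at h
    rw [d0_gen k he, h, ← act_smul_gen (k := k) he he i, ← mul_smul, act_mul, he, mul_one, sub_self]
    exact Z.zero_mem
  intro z hz
  have h : z - act k (d0 k e z) 1 • γ ∈ Z := by
    have : z ∈ T := hT ▸ Submodule.mem_top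
    exact this
  rwa [LinearMap.mem_ker.1 hz, act_zero_left, zero_smul, sub_zero] at h

/-- A derivation `D` of `B` that kills the vertices defines a bimodule map on `ker ∂⁰`, by
`∑ b ⊗ c ↦ ∑ b D(c)`; its composite with `∂¹` sends the generator of an arrow to its image
under `D`. -/
theorem exists_syzygy_map (he : ∀ i, e i * e i = e i) (hs : ∀ h, e (s h) * a h = a h)
    (ht : ∀ h, a h * e (t h) = a h) (D : B →ₗ[k] B) (hD : ∀ b c, D (b * c) = b * D c + D b * c)
    (hDe : ∀ i, D (e i) = 0) (f : P1 k e s t →ₗ[Env k B] B)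
    (hf : ∀ h, f (gen k _ _ h) = D (a h)) :
    ∃ g : LinearMap.ker (d0 k e) →ₗ[Env k B] B,
      ∀ p, g ⟨d1 k e a s t p, d0_d1 k he hs ht p⟩ = f p := by
  let μ : Env k B →+ B :=
    (TensorProduct.lift ((LinearMap.mul k B).compl₂
      (D ∘ₗ (MulOpposite.opLinearEquiv k (M := B)).symm.toLinearMap)) :
        B ⊗[k] Bᵐᵒᵖ →ₗ[k] B).toAddMonoidHom
  have hμ (b c : B) : μ (act k b c) = b * D c := rfl
  let G : P0 k e →+ B := DirectSum.toAddMonoid fun i =>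
    μ.comp (proj k (e i) (e i)).subtype.toAddMonoidHom
  have hG (b c : B) (i : V) : G (act k b c • gen k e e i) = b * e i * D (e i * c) := by
    rw [smul_gen]
    refine (DirectSum.toAddMonoid_of _ i _).trans ?_
    change μ (act k b c * act k (e i) (e i)) = _
    rw [act_mul, hμ]
  -- G is additive but not a bimodule map on P⁰. Its defect b ∂⁰(z) D(c) vanishes on ker ∂⁰.
  have hmul (b c : B) (z : P0 k e) :
      G (act k b c • z) = b * G z * c + b * d0 k e z * D c := by
    have key : ∀ z : P0 k e, ∀ b c, G (act k b c • z) = b * G z * c + b * d0 k e z * D c := by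
      let T : Submodule (Env k B) (P0 k e) :=
        { carrier := {z | ∀ b c, G (act k b c • z) = b * G z * c + b * d0 k e z * D c}
          add_mem' := fun {z w} hz hw b c => by
            rw [smul_add, map_add, hz, hw, map_add, map_add]
            noncomm_ring
          zero_mem' := fun b c => by simp
          smul_mem' := fun r z hz => by
            induction r using env_induction with
            | h0 => intro b c; simp
            | h p q =>
              intro b c
              rw [← mul_smul, act_mul, hz, hz, map_smul, act_smul, hD]
              noncomm_ring
            | hadd r r' hr hr' =>
              intro b c
              rw [add_smul, smul_add, map_add, hr, hr', map_add, map_add]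
              noncomm_ring }
      have hT : T = ⊤ := free_submodule_eq_top T fun i b c => by
        have h0 : G (gen k e e i) = 0 := by
          rw [← act_smul_gen (k := k) he he i, hG, he, hDe, mul_zero]
        rw [hG, h0, d0_gen k he, hD, hDe, zero_mul, add_zero, mul_zero, zero_mul, zero_add,
          mul_assoc b, ← mul_assoc (e i), he, ← mul_assoc]
      intro z
      have : z ∈ T := hT ▸ Submodule.mem_top
      exact this
    exact key z b c
  let g : LinearMap.ker (d0 k e) →ₗ[Env k B] B :=
    { toFun := fun z => G z.1
      map_add' := fun z w => map_add G z.1 w.1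
      map_smul' := fun r z => by
        change G (r • (z : P0 k e)) = r • G z
        induction r using env_induction with
        | h0 => rw [zero_smul, zero_smul, map_zero]
        | h b c => rw [hmul, LinearMap.mem_ker.1 z.2, mul_zero, zero_mul, add_zero, act_smul]
        | hadd r r' hr hr' => rw [add_smul, add_smul, map_add, hr, hr'] }
  refine ⟨g, fun p => ?_⟩
  refine LinearMap.congr_fun (f := g ∘ₗ (d1 k e a s t).codRestrict _ (d0_d1 k he hs ht))
    (hom_ext k fun h => ?_) p
  have hD1 : D 1 = 0 := by simpa using hD 1 1
  change G (d1 k e a s t (gen k _ _ h)) = _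
  rw [d1_gen he hs ht, map_sub, hG, hG, hf, one_mul, hs, mul_one, hDe, mul_zero, sub_zero]
  conv_rhs => rw [← hs h, hD, hDe, zero_mul, add_zero]

end Complex

end Hoch

/-! ### Generators of the Beilinson algebra, and values of cochains -/

namespace DownUp

open Hoch

variable {k : Type u} [Field k] {n m : ℕ} {α β : k}

theorem idem_mul_idem (i : Fin (2 * (n + m))) :
    idem n m α β i * idem n m α β i = idem n m α β i := idem_mul_elt i i rfl _ _

theorem idem_mul_idem_of_ne {i j : Fin (2 * (n + m))} (h : i ≠ j) :
    idem n m α β i * idem n m α β j = 0 :=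
  Subtype.ext (Matrix.single_mul_single_of_ne _ _ _ _ h _)

theorem idem_mul_arr (h : Arrow n m) : idem n m α β (src h) * arr α β h = arr α β h :=
  idem_mul_elt _ _ _ _ _

theorem arr_mul_idem (h : Arrow n m) : arr α β h * idem n m α β (tgt h) = arr α β h :=
  elt_mul_idem _ _ _ _ _

theorem exists_arrow {c : Letter} {i j : Fin (2 * (n + m))} (h : (j : ℕ) = i + weight n m c) :
    ∃ a : Arrow n m, lab a = c ∧ src a = i ∧ tgt a = j := by
  cases c
  · change (j : ℕ) = i + n at h
    exact ⟨.inl ⟨i, by omega⟩, rfl, rfl, Fin.ext h.symm⟩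
  · change (j : ℕ) = i + m at h
    exact ⟨.inr ⟨i, by omega⟩, rfl, rfl, Fin.ext h.symm⟩

/-- The vertices and arrows generate the Beilinson algebra. -/
theorem generated (S : Subalgebra k (NablaA n m α β)) (he : ∀ i, idem n m α β i ∈ S)
    (ha : ∀ h, arr α β h ∈ S) : S = ⊤ := by
  set T : Subalgebra k (Matrix (Fin (2 * (n + m))) (Fin (2 * (n + m))) (A α β)) :=
    Subalgebra.map (beilinson n m α β).val S with hT
  -- A word of weight j - i spells a path from i to j. The induction splits off its first arrow,
  -- whose target is still in range because the remaining weight leads up to j.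
  have hword (w : List Letter) : ∀ i j : Fin (2 * (n + m)),
      (j : ℕ) = i + (w.map (weight n m)).sum →
      Matrix.single i j (w.map (letter α β)).prod ∈ T := by
    induction w with
    | nil =>
      intro i j hij
      obtain rfl : j = i := Fin.ext (by simpa using hij)
      exact ⟨_, he j, rfl⟩
    | cons c w ih =>
      intro i j hij
      rw [List.map_cons, List.sum_cons] at hij
      obtain ⟨a, hc, hs, ht⟩ := exists_arrow (n := n) (m := m) (c := c) (i := i)
        (j := ⟨i + weight n m c, by omega⟩) rfl
      rw [List.map_cons, List.prod_cons,
        ← Matrix.single_mul_single_same (letter α β c) i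
          (⟨i + weight n m c, by omega⟩ : Fin (2 * (n + m))) j]
      refine T.mul_mem ⟨_, ha a, ?_⟩ (ih _ _ (by rw [hij, add_assoc]))
      change Matrix.single (src a) (tgt a) (letter α β (lab a)) = _
      rw [hc, hs, ht]
  have hcomp {d : ℕ} {a : A α β} (h : a ∈ comp n m α β d) (i j : Fin (2 * (n + m)))
      (hij : (j : ℕ) = i + d) : Matrix.single i j a ∈ T := by
    induction h using Submodule.span_induction with
    | mem a h =>
      obtain ⟨w, rfl, rfl⟩ := h
      exact hword w i j hij
    | zero => rw [Matrix.single_zero]; exact T.zero_mem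
    | add a b _ _ h h' => rw [Matrix.single_add]; exact T.add_mem h h'
    | smul r a _ h => rw [← Matrix.smul_single]; exact T.smul_mem h r
  refine eq_top_iff.2 fun M _ => ?_
  have hM : M.1 ∈ T := by
    rw [Matrix.matrix_eq_sum_single M.1]
    refine T.sum_mem fun i _ => T.sum_mem fun j _ => ?_
    have h := M.2 i j
    rw [entry] at h
    split_ifs at h with hij
    · exact hcomp h i j (by omega)
    · rw [(Submodule.mem_bot k).1 h, Matrix.single_zero]
      exact T.zero_mem
  obtain ⟨N, hN, h⟩ := hM
  obtain rfl : N = M := Subtype.ext h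
  exact hN

/-! ### The values of a cochain -/

/-- The value of a path of three letters starting at `i` under the derivation with values `v`. -/
def pathSum (α β : k) (n m : ℕ) (v : Letter → ℕ → A α β) (c d e : Letter) (i : ℕ) : A α β :=
  v c i * letter α β d * letter α β e +
    letter α β c * v d (i + weight n m c) * letter α β e +
    letter α β c * letter α β d * v e (i + weight n m c + weight n m d)

/-- The values on the arrows are compatible with the relations. -/
def Compatible (n m : ℕ) (v : Letter → ℕ → A α β) : Prop :=
  (∀ i < m, pathSum α β n m v .x .x .y i =
    β • pathSum α β n m v .y .x .x i + α • pathSum α β n m v .x .y .x i) ∧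
  ∀ j < n, pathSum α β n m v .x .y .y j =
    β • pathSum α β n m v .y .y .x j + α • pathSum α β n m v .y .x .y j

/-- The cochain `f` sends the generator of an arrow with letter `c` and source `i` to `v c i`. -/
def HasValues (f : Cochain n m α β) (v : Letter → ℕ → A α β) : Prop :=
  ∀ h : Arrow n m, (f (gen k _ _ h)).1 = Matrix.single (src h) (tgt h) (v (lab h) (src h))

theorem HasValues.add {f g : Cochain n m α β} {v w : Letter → ℕ → A α β} (hf : HasValues f v)
    (hg : HasValues g w) : HasValues (f + g) (v + w) := fun h => by
  have h1 : ((f + g) (gen k _ _ h)).1 = (f (gen k _ _ h)).1 + (g (gen k _ _ h)).1 := rfl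
  rw [h1, hf, hg, ← Matrix.single_add]
  rfl

theorem HasValues.smul {f : Cochain n m α β} {v : Letter → ℕ → A α β} (r : k)
    (hf : HasValues f v) : HasValues (r • f) (r • v) := fun h => by
  have h1 : ((r • f) (gen k _ _ h)).1 = r • (f (gen k _ _ h)).1 := rfl
  rw [h1, hf, Matrix.smul_single]
  rfl

theorem HasValues.ext {f g : Cochain n m α β} {v : Letter → ℕ → A α β} (hf : HasValues f v)
    (hg : HasValues g v) : f = g :=
  hom_ext k fun h => Subtype.ext ((hf h).trans (hg h).symm)

theorem exists_hasValues (f : Cochain n m α β) :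
    ∃ v, HasValues f v ∧ ∀ c i, v c i ∈ comp n m α β (weight n m c) := by
  classical
  set val : Arrow n m → A α β := fun h => (f (gen k _ _ h)).1 (src h) (tgt h)
  have hmem (h : Arrow n m) : val h ∈ comp n m α β (weight n m (lab h)) := by
    have := (f (gen k _ _ h)).2 (src h) (tgt h)
    rwa [entry, if_pos (by rw [tgt_eq]; omega), tgt_eq, Nat.add_sub_cancel_left] at this
  -- A letter and a source determine at most one arrow. The default 0 where there is none keeps the
  -- degree condition valid for every index.
  refine ⟨fun c i => if h : ∃ a : Arrow n m, lab a = c ∧ (src a : ℕ) = i then val h.choose else 0,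
    fun h => ?_, fun c i => ?_⟩
  · have hex : ∃ a : Arrow n m, lab a = lab h ∧ (src a : ℕ) = src h := ⟨h, rfl, rfl⟩
    have hch : hex.choose = h := by
      obtain ⟨h1, h2⟩ := hex.choose_spec
      generalize hex.choose = a at h1 h2
      rcases a with a | a <;> rcases h with h | h <;> simp_all [lab, src, Fin.ext_iff]
    beta_reduce
    refine Eq.trans ?_ (congrArg (Matrix.single _ _) ((dif_pos hex).trans (congrArg val hch)).symm)
    have := congrArg Subtype.val (map_gen_eq (k := k) (s := src) (t := tgt)
      (idem_mul_idem (n := n) (m := m) (α := α) (β := β)) f h)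
    rw [← this]
    refine (Matrix.single_mul_mul_single _ _ _ _ _ _ _).trans ?_
    rw [one_mul, mul_one]
  · dsimp only
    split_ifs with h
    · have h1 := hmem h.choose
      rwa [h.choose_spec.1] at h1
    · exact zero_mem _

theorem hasValues_path {f : Cochain n m α β} {v : Letter → ℕ → A α β} (hf : HasValues f v)
    {p q r : Arrow n m} {s t : Fin (2 * (n + m))} (hs : src p = s) (hpq : tgt p = src q)
    (hqr : tgt q = src r) (ht : tgt r = t) :
    (f (path α β p q r)).1 = Matrix.single s t
      (pathSum α β n m v (lab p) (lab q) (lab r) s) := by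
  subst hs ht
  rw [path, map_pathTerm]
  change (f (gen k _ _ p)).1 * (arr α β q).1 * (arr α β r).1 +
    (arr α β p).1 * (f (gen k _ _ q)).1 * (arr α β r).1 +
    (arr α β p).1 * (arr α β q).1 * (f (gen k _ _ r)).1 = _
  have harr (h : Arrow n m) :
      (arr α β h).1 = Matrix.single (src h) (tgt h) (letter α β (lab h)) := rfl
  have hq : (src q : ℕ) = src p + weight n m (lab p) := by rw [← hpq, tgt_eq]
  have hr : (src r : ℕ) = src p + weight n m (lab p) + weight n m (lab q) := by
    rw [← hqr, tgt_eq, hq]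
  rw [hf, hf, hf, harr, harr, harr, hpq, hqr, Matrix.single_mul_single_same,
    Matrix.single_mul_single_same, Matrix.single_mul_single_same, Matrix.single_mul_single_same,
    Matrix.single_mul_single_same, Matrix.single_mul_single_same, ← Matrix.single_add,
    ← Matrix.single_add, pathSum, hq, hr]

/-- All paths of a relation share source and target, so f∂² on its generator has a single possibly
nonzero entry, and its vanishing is one identity in A. -/
theorem cocycle_iff {f : Cochain n m α β} {v : Letter → ℕ → A α β} (hf : HasValues f v) :
    f ∘ₗ D2 n m α β = 0 ↔ Compatible n m v := by
  have hgen (h : Reln n m) {a : A α β}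
      (ha : (f (relTerm n m α β h)).1 = Matrix.single (rsrc h) (rtgt h) a) :
      (f ∘ₗ D2 n m α β) (gen k _ _ h) = 0 ↔ a = 0 := by
    have h1 : ((f ∘ₗ D2 n m α β) (gen k _ _ h)).1 = Matrix.single (rsrc h) (rtgt h) a := by
      rw [LinearMap.comp_apply, D2, ofGens_gen, map_smul, act_smul]
      change Matrix.single _ _ _ * (f (relTerm n m α β h)).1 * Matrix.single _ _ _ = _
      rw [ha, Matrix.single_mul_single_same, Matrix.single_mul_single_same, one_mul, mul_one]
    refine Subtype.ext_iff.trans ?_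
    rw [h1]
    refine ⟨fun h0 => ?_, fun h0 => by rw [h0, Matrix.single_zero]; rfl⟩
    rw [← Matrix.single_apply_same (rsrc h) (rtgt h) a, h0]
    rfl
  have hsingle (i j : Fin (2 * (n + m))) (a b : A α β) :
      Matrix.single i j a - Matrix.single i j b = Matrix.single i j (a - b) :=
    (map_sub (Matrix.singleAddMonoidHom i j) a b).symm
  have hsub (p q r : Q1 n m α β) :
      (f (p - algebraMap k (Env k (NablaA n m α β)) α • q -
        algebraMap k (Env k (NablaA n m α β)) β • r)).1 =
      (f p).1 - α • (f q).1 - β • (f r).1 := by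
    rw [map_sub, map_sub, map_smul, map_smul, algebraMap_smul, algebraMap_smul]
    rfl
  have hx (i : Fin m) : (f (relTerm n m α β (.inl i))).1 =
      Matrix.single (rsrc (.inl i)) (rtgt (n := n) (.inl i))
        (pathSum α β n m v .x .x .y i - α • pathSum α β n m v .x .y .x i -
          β • pathSum α β n m v .y .x .x i) := by
    refine (hsub _ _ _).trans ?_
    rw [hasValues_path hf (s := rsrc (.inl i)) (t := rtgt (.inl i)), hasValues_path hf
        (s := rsrc (.inl i)) (t := rtgt (.inl i)), hasValues_path hf (s := rsrc (.inl i)) (t := rtgt (.inl i)),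
      Matrix.smul_single, Matrix.smul_single, hsingle, hsingle]
    · rfl
    all_goals
      first
      | rfl
      | exact Fin.ext (by dsimp only [ax, ay, src, tgt, rsrc, rtgt]; omega)
  have hy (j : Fin n) : (f (relTerm n m α β (.inr j))).1 =
      Matrix.single (rsrc (.inr j)) (rtgt (m := m) (.inr j))
        (pathSum α β n m v .x .y .y j - α • pathSum α β n m v .y .x .y j -
          β • pathSum α β n m v .y .y .x j) := by
    refine (hsub _ _ _).trans ?_
    rw [hasValues_path hf (s := rsrc (.inr j)) (t := rtgt (.inr j)), hasValues_path hf
        (s := rsrc (.inr j)) (t := rtgt (.inr j)), hasValues_path hf (s := rsrc (.inr j)) (t := rtgt (.inr j)),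
      Matrix.smul_single, Matrix.smul_single, hsingle, hsingle]
    · rfl
    all_goals
      first
      | rfl
      | exact Fin.ext (by dsimp only [ax, ay, src, tgt, rsrc, rtgt]; omega)
  constructor
  · intro h0
    refine ⟨fun i hi => ?_, fun j hj => ?_⟩
    · have := (hgen (.inl ⟨i, hi⟩) (hx ⟨i, hi⟩)).1 (by rw [h0]; rfl)
      rw [sub_sub, sub_eq_zero] at this
      rw [this, add_comm]
    · have := (hgen (.inr ⟨j, hj⟩) (hy ⟨j, hj⟩)).1 (by rw [h0]; rfl)
      rw [sub_sub, sub_eq_zero] at this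
      rw [this, add_comm]
  · rintro ⟨h1, h2⟩
    refine hom_ext k fun h => ?_
    rcases h with i | j
    · refine (hgen (.inl i) (hx i)).2 ?_
      rw [h1 i i.2]
      abel
    · refine (hgen (.inr j) (hy j)).2 ?_
      rw [h2 j j.2]
      abel

end DownUp

/-- The `l × l` matrix whose `(i, i + d)` entries are `u i`, and whose other entries vanish. -/
def Matrix.band {R : Type*} [Zero R] (l d : ℕ) (u : ℕ → R) : Matrix (Fin l) (Fin l) R :=
  Matrix.of fun i j => if (j : ℕ) = i + d then u i else 0

/-! ### Calculus of band matrices -/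

namespace Matrix

section

variable {R : Type*} {l : ℕ}

theorem band_apply [Zero R] (d : ℕ) (u : ℕ → R) (i j : Fin l) :
    band l d u i j = if (j : ℕ) = i + d then u i else 0 := rfl

theorem band_mul [NonUnitalNonAssocSemiring R] (c d : ℕ) (u w : ℕ → R) :
    band l c u * band l d w = band l (c + d) fun i => u i * w (i + c) := by
  ext i j
  rw [mul_apply, band_apply]
  by_cases h : (i : ℕ) + c < l
  · rw [Finset.sum_eq_single ⟨i + c, h⟩]
    · rw [band_apply, band_apply, if_pos rfl, add_assoc]
      split_ifs <;> simp
    · intro p _ hp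
      rw [band_apply, if_neg (fun hpc => hp (Fin.ext hpc)), zero_mul]
    · simp
  · rw [if_neg (by omega)]
    refine Finset.sum_eq_zero fun p _ => ?_
    rw [band_apply, if_neg (by omega), zero_mul]

theorem band_add [AddZeroClass R] (d : ℕ) (u w : ℕ → R) :
    band l d u + band l d w = band l d (u + w) := by
  ext i j
  rw [add_apply, band_apply, band_apply, band_apply]
  split_ifs <;> simp

theorem smul_band {S : Type*} [Zero R] [SMulZeroClass S R] (r : S) (d : ℕ) (u : ℕ → R) :
    r • band l d u = band l d (r • u) := by
  ext i j
  rw [smul_apply, band_apply, band_apply]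
  split_ifs <;> simp

theorem band_congr [Zero R] {d : ℕ} {u w : ℕ → R} (h : ∀ i, i + d < l → u i = w i) :
    band l d u = band l d w := by
  ext i j
  rw [band_apply, band_apply]
  split_ifs with hj
  · exact h i (by omega)
  · rfl

theorem band_zero_one [Zero R] [One R] : band l 0 (fun _ => (1 : R)) = 1 := by
  ext i j
  rw [band_apply, one_apply]
  simp only [add_zero, Fin.ext_iff, eq_comm]

end

end Matrix

/-! ### From cocycles to derivations and to a basis of HH¹ -/

namespace DownUp

open Hoch Matrix TrivSqZeroExt

variable {k : Type u} [Field k] {n m : ℕ} {α β : k}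

/-- The matrices over the dual numbers of `A` that deform the shift matrices of the letters. -/
def deformLetter (n m : ℕ) (v : Letter → ℕ → A α β) (c : Letter) :
    Matrix (Fin (2 * (n + m))) (Fin (2 * (n + m))) (DualNumber (A α β)) :=
  band _ (weight n m c) fun i => inl (letter α β c) + inr (v c i)

/-- Because ε² = 0, the ε-part of a product is its Leibniz expansion, which is `pathSum`. -/
theorem deformLetter_mul (v : Letter → ℕ → A α β) (c d e : Letter) :
    deformLetter n m v c * deformLetter n m v d * deformLetter n m v e =
      band _ (weight n m c + weight n m d + weight n m e) fun i =>
        inl (letter α β c * letter α β d * letter α β e) + inr (pathSum α β n m v c d e i) := by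
  rw [deformLetter, deformLetter, deformLetter, band_mul, band_mul]
  congr 1
  funext i
  ext
  · simp
  · simp only [pathSum, fst_mul, snd_mul, fst_add, snd_add, fst_inl, fst_inr, snd_inl, snd_inr,
      add_zero, zero_add, smul_eq_mul, op_smul_eq_mul, add_mul, zero_mul]
    abel_nf

theorem letter_xxy : letter α β .x * letter α β .x * letter α β .y =
    β • (letter α β .y * letter α β .x * letter α β .x) +
      α • (letter α β .x * letter α β .y * letter α β .x) := by
  have h := RingQuot.mkAlgHom_rel k (Rel.xxy (α := α) (β := β))
  simp only [map_add, map_smul, map_mul] at h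
  exact h

theorem letter_xyy : letter α β .x * letter α β .y * letter α β .y =
    β • (letter α β .y * letter α β .y * letter α β .x) +
      α • (letter α β .y * letter α β .x * letter α β .y) := by
  have h := RingQuot.mkAlgHom_rel k (Rel.xyy (α := α) (β := β))
  simp only [map_add, map_smul, map_mul] at h
  exact h

/-- Algebra homomorphisms out of the down-up algebra. -/
theorem exists_algHom {B : Type*} [Ring B] [Algebra k B] (u : Letter → B)
    (h1 : u .x * u .x * u .y = β • (u .y * u .x * u .x) + α • (u .x * u .y * u .x))
    (h2 : u .x * u .y * u .y = β • (u .y * u .y * u .x) + α • (u .y * u .x * u .y)) :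
    ∃ Φ : A α β →ₐ[k] B, ∀ c, Φ (letter α β c) = u c := by
  refine ⟨RingQuot.liftAlgHom k ⟨FreeAlgebra.lift k u, ?_⟩, fun c => ?_⟩
  · rintro _ _ (_ | _)
    · simpa [free] using h1
    · simpa [free] using h2
  · exact (RingQuot.liftAlgHom_mkAlgHom_apply _ _ _ _).trans (FreeAlgebra.lift_ι_apply _ _)

/-- The matrix size does the truncation: in size 2(n+m) a band at offset 2n + m has m rows and one
at offset n + 2m has n rows. The relations are therefore needed only at the vertices where f_i and
g_j start. -/
theorem exists_deformation {v : Letter → ℕ → A α β} (hv : Compatible n m v) :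
    ∃ Φ : A α β →ₐ[k] Matrix (Fin (2 * (n + m))) (Fin (2 * (n + m))) (DualNumber (A α β)),
      ∀ c, Φ (letter α β c) = deformLetter n m v c := by
  refine exists_algHom _ ?_ ?_
  · rw [deformLetter_mul, deformLetter_mul, deformLetter_mul,
      show weight n m .y + weight n m .x + weight n m .x =
        weight n m .x + weight n m .x + weight n m .y by ring,
      show weight n m .x + weight n m .y + weight n m .x =
        weight n m .x + weight n m .x + weight n m .y by ring, smul_band, smul_band, band_add]
    refine band_congr fun i hi => ?_
    rw [letter_xxy, hv.1 i (by simp only [weight] at hi; omega)]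
    ext <;> simp
  · rw [deformLetter_mul, deformLetter_mul, deformLetter_mul,
      show weight n m .y + weight n m .y + weight n m .x =
        weight n m .x + weight n m .y + weight n m .y by ring,
      show weight n m .y + weight n m .x + weight n m .y =
        weight n m .x + weight n m .y + weight n m .y by ring, smul_band, smul_band, band_add]
    refine band_congr fun i hi => ?_
    rw [letter_xyy, hv.2 i (by simp only [weight] at hi; omega)]
    ext <;> simp

/-- The ε-parts keep the degree, so they are admissible entries of ∇A; the constant part a is what
makes them obey the Leibniz rule. -/
theorem deformation_homogeneous {v : Letter → ℕ → A α β}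
    (hmem : ∀ c i, v c i ∈ comp n m α β (weight n m c))
    {Φ : A α β →ₐ[k] Matrix (Fin (2 * (n + m))) (Fin (2 * (n + m))) (DualNumber (A α β))}
    (hΦ : ∀ c, Φ (letter α β c) = deformLetter n m v c) {d : ℕ} {a : A α β}
    (ha : a ∈ comp n m α β d) :
    ∃ u : ℕ → A α β, (∀ i, u i ∈ comp n m α β d) ∧ Φ a = band _ d fun i => inl a + inr (u i) := by
  induction ha using Submodule.span_induction with
  | mem a h =>
    obtain ⟨w, rfl, rfl⟩ := h
    induction w with
    | nil =>
      refine ⟨0, fun i => zero_mem _, ?_⟩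
      rw [List.map_nil, List.map_nil, List.sum_nil, List.prod_nil, map_one, ← band_zero_one]
      congr 1
      funext i
      ext <;> simp
    | cons c w ih =>
      obtain ⟨u, hu, hw⟩ := ih
      refine ⟨fun i => letter α β c * u (i + weight n m c) + v c i * (w.map (letter α β)).prod,
        fun i => ?_, ?_⟩
      · exact add_mem (mul_mem_comp (letter_mem n m α β c) (hu _))
          (mul_mem_comp (hmem c i) (Submodule.subset_span ⟨w, rfl, rfl⟩))
      · rw [List.map_cons, List.map_cons, List.sum_cons, List.prod_cons, map_mul, hw, hΦ,
          deformLetter, band_mul]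
        congr 1
        funext i
        ext <;> simp
  | zero =>
    refine ⟨0, fun i => zero_mem _, ?_⟩
    rw [map_zero]
    ext i j <;> simp [band_apply]
  | add a b _ _ h h' =>
    obtain ⟨u, hu, h⟩ := h
    obtain ⟨w, hw, h'⟩ := h'
    refine ⟨u + w, fun i => add_mem (hu i) (hw i), ?_⟩
    rw [map_add, h, h', band_add]
    congr 1
    funext i
    ext <;> simp
  | smul r a _ h =>
    obtain ⟨u, hu, h⟩ := h
    refine ⟨r • u, fun i => Submodule.smul_mem _ _ (hu i), ?_⟩
    rw [map_smul, h, smul_band]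
    congr 1
    funext i
    ext <;> simp

/-- Compatible values on the arrows extend to a derivation of the Beilinson algebra. -/
theorem exists_derivation {v : Letter → ℕ → A α β}
    (hmem : ∀ c i, v c i ∈ comp n m α β (weight n m c)) (hv : Compatible n m v) :
    ∃ D : NablaA n m α β →ₗ[k] NablaA n m α β, (∀ b c, D (b * c) = b * D c + D b * c) ∧
      (∀ i, D (idem n m α β i) = 0) ∧
      ∀ h : Arrow n m, (D (arr α β h)).1 = Matrix.single (src h) (tgt h) (v (lab h) (src h)) := by
  obtain ⟨Φ, hΦ⟩ := exists_deformation hv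
  have hhom {d : ℕ} {a : A α β} (ha : a ∈ comp n m α β d) := deformation_homogeneous hmem hΦ ha
  have hentry {i j : Fin (2 * (n + m))} {a : A α β} (ha : a ∈ entry n m α β i j) :
      (Φ a i j).snd ∈ entry n m α β i j := by
    rw [entry] at ha ⊢
    split_ifs at ha ⊢ with hij
    · obtain ⟨u, hu, h⟩ := hhom ha
      rw [h, band_apply, if_pos (by omega)]
      simpa using hu i
    · rw [(Submodule.mem_bot k).1 ha, map_zero]
      exact zero_mem _
  have hleib {i l j : Fin (2 * (n + m))} {a b : A α β} (ha : a ∈ entry n m α β i l)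
      (hb : b ∈ entry n m α β l j) :
      (Φ (a * b) i j).snd = a * (Φ b l j).snd + (Φ a i l).snd * b := by
    rw [entry] at ha hb
    split_ifs at ha with hil
    · split_ifs at hb with hlj
      · obtain ⟨u, hu, h⟩ := hhom ha
        obtain ⟨w, hw, h'⟩ := hhom hb
        rw [map_mul, h, h', band_mul, band_apply, band_apply, band_apply, if_pos (by omega),
          if_pos (by omega), if_pos (by omega), show (i : ℕ) + (l - i) = l by omega]
        simp
      · rw [(Submodule.mem_bot k).1 hb]
        simp
    · rw [(Submodule.mem_bot k).1 ha]
      simp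
  -- The rows of the target of Φ record the source vertex: the entry of M at (i, j) is sent to the
  -- ε-part of the (i, j) entry of its image under Φ.
  let D : NablaA n m α β →ₗ[k] NablaA n m α β :=
    { toFun := fun M => ⟨Matrix.of fun i j => (Φ (M.1 i j) i j).snd, fun i j => hentry (M.2 i j)⟩
      map_add' := fun M N => Subtype.ext <| Matrix.ext fun i j => by
        change (Φ (M.1 i j + N.1 i j) i j).snd = (Φ (M.1 i j) i j).snd + (Φ (N.1 i j) i j).snd
        rw [map_add, Matrix.add_apply, snd_add]
      map_smul' := fun r M => Subtype.ext <| Matrix.ext fun i j => by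
        change (Φ (r • M.1 i j) i j).snd = r • (Φ (M.1 i j) i j).snd
        rw [map_smul, Matrix.smul_apply, snd_smul] }
  have hsingle (M : NablaA n m α β) {i j : Fin (2 * (n + m))} {a : A α β}
      (h : M.1 = Matrix.single i j a) : (D M).1 = Matrix.single i j (Φ a i j).snd := by
    ext i' j'
    change (Φ (M.1 i' j') i' j').snd = _
    rw [h, single_apply, single_apply]
    split_ifs with hij
    · rw [hij.1, hij.2]
    · simp
  refine ⟨D, fun M N => Subtype.ext <| Matrix.ext fun i j => ?_, fun i => Subtype.ext ?_,
    fun h => ?_⟩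
  · change (Φ ((M.1 * N.1) i j) i j).snd = (M.1 * (D N).1) i j + ((D M).1 * N.1) i j
    rw [mul_apply, mul_apply, mul_apply, map_sum, Matrix.sum_apply, snd_sum,
      ← Finset.sum_add_distrib]
    exact Finset.sum_congr rfl fun l _ => hleib (M.2 i l) (N.2 l j)
  · rw [hsingle _ (rfl : (idem n m α β i).1 = Matrix.single i i 1), map_one, one_apply_eq,
      snd_one, single_zero]
    rfl
  · rw [hsingle _ (rfl : (arr α β h).1 = Matrix.single (src h) (tgt h) (letter α β (lab h))), hΦ,
      deformLetter, band_apply, if_pos (tgt_eq h)]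
    simp

/-- Plays the role of exactness at P¹: the derivation built from f supplies the factorization
through the syzygy. -/
theorem exists_isClass {f : Cochain n m α β} (hf : f ∘ₗ D2 n m α β = 0) :
    ∃ g : LinearMap.ker (D0 n m α β) →ₗ[Env k (NablaA n m α β)] NablaA n m α β,
      ∀ p, g ⟨D1 n m α β p, D0_D1 n m α β p⟩ = f p := by
  obtain ⟨v, hv, hmem⟩ := exists_hasValues f
  obtain ⟨D, hD, hDe, hDa⟩ := exists_derivation hmem ((cocycle_iff hv).1 hf)
  exact exists_syzygy_map idem_mul_idem idem_mul_arr arr_mul_idem D hD hDe f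
    fun h => Subtype.ext ((hv h).trans (hDa h).symm)

/-- After telescoping, each path contributes only its product, and the products satisfy the
relations of A. -/
theorem D1_comp_D2 : D1 n m α β ∘ₗ D2 n m α β = 0 := by
  have hpath {p q r : Arrow n m} {i j : Fin (2 * (n + m))} (hs : src p = i) (hpq : tgt p = src q)
      (hqr : tgt q = src r) (ht : tgt r = j) : D1 n m α β (path α β p q r) =
        act k 1 (arr α β p * arr α β q * arr α β r) • gen k _ _ i -
          act k (arr α β p * arr α β q * arr α β r) 1 • gen k _ _ j := by
    subst hs ht
    exact d1_pathTerm idem_mul_idem idem_mul_arr arr_mul_idem hpq hqr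
  have hprod {p q r : Arrow n m} {i j : Fin (2 * (n + m))} (hs : src p = i) (hpq : tgt p = src q)
      (hqr : tgt q = src r) (ht : tgt r = j) : (arr α β p * arr α β q * arr α β r).1 =
        Matrix.single i j (letter α β (lab p) * letter α β (lab q) * letter α β (lab r)) := by
    subst hs ht
    change Matrix.single _ _ _ * Matrix.single _ _ _ * Matrix.single _ _ _ = _
    rw [hpq, hqr, single_mul_single_same, single_mul_single_same]
  have hrel (r : k) (b : NablaA n m α β) (i j : Fin (2 * (n + m))) :
      algebraMap k (Env k (NablaA n m α β)) r •
        (act k 1 b • gen k (idem n m α β) (idem n m α β) i - act k b 1 • gen k _ _ j) =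
      act k 1 (r • b) • gen k _ _ i - act k (r • b) 1 • gen k _ _ j := by
    rw [smul_sub, ← mul_smul, ← mul_smul, ← Algebra.smul_def, ← Algebra.smul_def,
      act_smul_right, ← smul_act]
  have hzero {p q r p' q' r' p'' q'' r'' : Arrow n m} {i j : Fin (2 * (n + m))}
      (h1 : src p = i ∧ tgt p = src q ∧ tgt q = src r ∧ tgt r = j)
      (h2 : src p' = i ∧ tgt p' = src q' ∧ tgt q' = src r' ∧ tgt r' = j)
      (h3 : src p'' = i ∧ tgt p'' = src q'' ∧ tgt q'' = src r'' ∧ tgt r'' = j)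
      (h : letter α β (lab p) * letter α β (lab q) * letter α β (lab r) =
        β • (letter α β (lab p'') * letter α β (lab q'') * letter α β (lab r'')) +
          α • (letter α β (lab p') * letter α β (lab q') * letter α β (lab r'))) :
      D1 n m α β (path α β p q r - algebraMap k (Env k (NablaA n m α β)) α • path α β p' q' r' -
        algebraMap k (Env k (NablaA n m α β)) β • path α β p'' q'' r'') = 0 := by
    obtain ⟨a1, b1, c1, d1⟩ := h1
    obtain ⟨a2, b2, c2, d2⟩ := h2
    obtain ⟨a3, b3, c3, d3⟩ := h3
    have hP : arr α β p * arr α β q * arr α β r = β • (arr α β p'' * arr α β q'' * arr α β r'') +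
        α • (arr α β p' * arr α β q' * arr α β r') := by
      refine Subtype.ext ((hprod a1 b1 c1 d1).trans ?_)
      change _ = β • (arr α β p'' * arr α β q'' * arr α β r'').1 +
        α • (arr α β p' * arr α β q' * arr α β r').1
      rw [hprod a2 b2 c2 d2, hprod a3 b3 c3 d3, h, smul_single, smul_single, single_add]
    rw [map_sub, map_sub, map_smul, map_smul, hpath a1 b1 c1 d1, hpath a2 b2 c2 d2,
      hpath a3 b3 c3 d3, hrel, hrel, hP, act_add_left, act_add_right, add_smul, add_smul]
    abel
  refine hom_ext k fun h => ?_
  rw [LinearMap.comp_apply, D2, ofGens_gen, map_smul, LinearMap.zero_apply]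
  rcases h with i | j
  · refine (congrArg _ (hzero (i := rsrc (.inl i)) (j := rtgt (.inl i)) ?_ ?_ ?_ letter_xxy)).trans
      (smul_zero _)
    all_goals
      refine ⟨?_, ?_, ?_, ?_⟩ <;>
        exact Fin.ext (by simp only [ax, ay, src, tgt, rsrc, rtgt] <;> omega)
  · refine (congrArg _ (hzero (i := rsrc (.inr j)) (j := rtgt (.inr j)) ?_ ?_ ?_ letter_xyy)).trans
      (smul_zero _)
    all_goals
      refine ⟨?_, ?_, ?_, ?_⟩ <;>
        exact Fin.ext (by simp only [ax, ay, src, tgt, rsrc, rtgt] <;> omega)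

/-- Cocycles that form a basis modulo coboundaries give a basis of `HH¹`. -/
theorem isHHBasis_of {N : ℕ} {f : Fin N → Cochain n m α β} (hf : ∀ i, f i ∘ₗ D2 n m α β = 0)
    (hli : ∀ c : Fin N → k, IsCoboundary n m α β (∑ i, c i • f i) → c = 0)
    (hspan : ∀ g : Cochain n m α β, g ∘ₗ D2 n m α β = 0 →
      ∃ c : Fin N → k, IsCoboundary n m α β (g - ∑ i, c i • f i)) : IsHHBasis n m α β f := by
  choose g hg using fun i => exists_isClass (hf i)
  have hsurj (z : LinearMap.ker (D0 n m α β)) :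
      ∃ p, (⟨D1 n m α β p, D0_D1 n m α β p⟩ : LinearMap.ker (D0 n m α β)) = z := by
    obtain ⟨p, hp⟩ := ker_d0_le_range_d1 (k := k) (e := idem n m α β) (a := arr α β) (s := src)
      (t := tgt) idem_mul_idem (fun _ _ => idem_mul_idem_of_ne) idem_mul_arr arr_mul_idem
      generated z.2
    exact ⟨p, Subtype.ext hp⟩
  have hproj : Module.Projective (Env k (NablaA n m α β)) (P0 k (idem n m α β)) :=
    projective_free idem_mul_idem idem_mul_idem
  set δ := connectingHom (D0 n m α β) (D0_surjective n m α β)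
  -- Since ∂¹ is onto ker ∂⁰, a map on the syzygy extends to P⁰ exactly when its composite with ∂¹
  -- is a coboundary.
  have hcob (g' : LinearMap.ker (D0 n m α β) →ₗ[Env k (NablaA n m α β)]
      NablaA n m α β) (f' : Cochain n m α β)
      (hg' : ∀ p, g' ⟨D1 n m α β p, D0_D1 n m α β p⟩ = f' p) :
      δ g' = 0 ↔ IsCoboundary n m α β f' := by
    refine (connecting_eq_zero_iff (D0 n m α β) (D0_surjective n m α β) g').trans ⟨?_, ?_⟩
    · rintro ⟨φ, rfl⟩
      exact ⟨φ, LinearMap.ext fun p => (hg' p).symm⟩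
    · rintro ⟨φ, rfl⟩
      refine ⟨φ, LinearMap.ext fun z => ?_⟩
      obtain ⟨p, rfl⟩ := hsurj z
      exact (hg' p).symm
  have hsum (c : Fin N → k) (p : Q1 n m α β) :
      (∑ i, c i • g i) ⟨D1 n m α β p, D0_D1 n m α β p⟩ = (∑ i, c i • f i) p := by
    simp only [LinearMap.sum_apply, LinearMap.smul_apply, hg]
  have hli' : LinearIndependent k fun i => δ (g i) := by
    rw [Fintype.linearIndependent_iff]
    intro c hc
    simp only [← map_smul, ← map_sum] at hc
    exact congrFun (hli c ((hcob _ _ (hsum c)).1 hc))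
  have hspan' : ⊤ ≤ Submodule.span k (Set.range fun i => δ (g i)) := by
    rintro z -
    obtain ⟨g', rfl⟩ := connecting_surjective (D0 n m α β) (D0_surjective n m α β) z
    set f' : Cochain n m α β := g' ∘ₗ (D1 n m α β).codRestrict _ (D0_D1 n m α β) with hf'
    have hf2 : f' ∘ₗ D2 n m α β = 0 := by
      refine LinearMap.ext fun p => ?_
      have h0 : (D1 n m α β).codRestrict _ (D0_D1 n m α β) (D2 n m α β p) = 0 :=
        Subtype.ext (LinearMap.congr_fun D1_comp_D2 p)
      rw [hf', LinearMap.comp_apply, LinearMap.comp_apply, h0, map_zero, LinearMap.zero_apply]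
    obtain ⟨c, hc⟩ := hspan f' hf2
    have h0 := (hcob (g' - ∑ i, c i • g i) _ fun p => by
      rw [LinearMap.sub_apply, LinearMap.sub_apply, hsum]
      rfl).2 hc
    rw [map_sub, sub_eq_zero, map_sum] at h0
    change δ g' ∈ _
    rw [h0]
    refine sum_mem fun i _ => ?_
    rw [map_smul]
    exact Submodule.smul_mem _ _ (Submodule.subset_span ⟨i, rfl⟩)
  refine ⟨Module.Basis.mk hli' hspan', fun i => ⟨hf i, g i, hg i, ?_⟩⟩
  rw [Module.Basis.mk_apply]
  rfl

end DownUp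

/-! ### Shift representations and independence of words -/

namespace DownUp

variable {k : Type u} [Field k] {α β : k}

theorem lam_two (hβ : β ≠ 0) : lam α β 2 = 1 := by
  simp [lam, mul_inv_cancel₀ hβ]

theorem lam_succ_succ (r : ℕ) : lam α β (r + 2) = α * lam α β (r + 1) + β * lam α β r := rfl

/-- The representation on sequences in which `x` is the shift. -/
theorem exists_shift_x (α β : k) : ∃ Φ : A α β →ₐ[k] Module.End k (ℕ → k), ∀ f i,
    Φ (letter α β .x) f i = f (i + 1) ∧
      Φ (letter α β .y) f i = lam α β (i + 1) * f (i - 1) := by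
  let u : Letter → Module.End k (ℕ → k) := fun
    | .x =>
      { toFun := fun f i => f (i + 1)
        map_add' := fun _ _ => rfl
        map_smul' := fun _ _ => rfl }
    -- The weight is λ_i, and λ_0 = 0 makes the truncated index i - 1 harmless at i = 0.
    | .y =>
      { toFun := fun f i => lam α β (i + 1) * f (i - 1)
        map_add' := fun f g => funext fun i => mul_add _ _ _
        map_smul' := fun r f => funext fun i => mul_left_comm _ _ _ }
  have hx (f : ℕ → k) (i : ℕ) : u .x f i = f (i + 1) := rfl
  have hy (f : ℕ → k) (i : ℕ) : u .y f i = lam α β (i + 1) * f (i - 1) := rfl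
  obtain ⟨Φ, hΦ⟩ := exists_algHom (α := α) (β := β) u
    (by
      refine LinearMap.ext fun f => funext fun i => ?_
      simp only [LinearMap.add_apply, LinearMap.smul_apply, Module.End.mul_apply, Pi.add_apply,
        Pi.smul_apply, smul_eq_mul, hx, hy]
      rcases i with _ | i
      · simp [lam, mul_assoc]
      · simp [lam_succ_succ (i + 1 + 1)]
        ring)
    (by
      refine LinearMap.ext fun f => funext fun i => ?_
      simp only [LinearMap.add_apply, LinearMap.smul_apply, Module.End.mul_apply, Pi.add_apply,
        Pi.smul_apply, smul_eq_mul, hx, hy]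
      rcases i with _ | _ | i
      · simp [lam]
      · simp [lam]
        ring
      · simp [lam_succ_succ (i + 1 + 1)]
        ring)
  exact ⟨Φ, fun f i => by rw [hΦ, hΦ]; exact ⟨rfl, rfl⟩⟩

/-- The representation on sequences in which `y` is the shift. -/
theorem exists_shift_y (α β : k) : ∃ Φ : A α β →ₐ[k] Module.End k (ℕ → k), ∀ f i,
    Φ (letter α β .x) f i = lam α β (i + 2) * f (i + 1) ∧
      Φ (letter α β .y) f i = if i = 0 then 0 else f (i - 1) := by
  let u : Letter → Module.End k (ℕ → k) := fun
    | .x =>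
      { toFun := fun f i => lam α β (i + 2) * f (i + 1)
        map_add' := fun f g => funext fun i => mul_add _ _ _
        map_smul' := fun r f => funext fun i => mul_left_comm _ _ _ }
    | .y =>
      { toFun := fun f i => if i = 0 then 0 else f (i - 1)
        map_add' := fun f g => funext fun i => by simp only [Pi.add_apply]; split_ifs <;> simp
        map_smul' := fun r f => funext fun i => by simp }
  have hx (f : ℕ → k) (i : ℕ) : u .x f i = lam α β (i + 2) * f (i + 1) := rfl
  have hy (f : ℕ → k) (i : ℕ) : u .y f i = if i = 0 then 0 else f (i - 1) := rfl
  obtain ⟨Φ, hΦ⟩ := exists_algHom (α := α) (β := β) u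
    (by
      refine LinearMap.ext fun f => funext fun i => ?_
      simp only [LinearMap.add_apply, LinearMap.smul_apply, Module.End.mul_apply, Pi.add_apply,
        Pi.smul_apply, smul_eq_mul, hx, hy]
      rcases i with _ | i
      · simp [lam]
        ring
      · simp [lam_succ_succ (i + 1 + 1)]
        ring)
    (by
      refine LinearMap.ext fun f => funext fun i => ?_
      simp only [LinearMap.add_apply, LinearMap.smul_apply, Module.End.mul_apply, Pi.add_apply,
        Pi.smul_apply, smul_eq_mul, hx, hy]
      rcases i with _ | _ | i
      · simp
      · simp [lam]
        ring
      · simp [lam_succ_succ (i + 1 + 1)]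
        ring)
  exact ⟨Φ, fun f i => by rw [hΦ, hΦ]; exact ⟨rfl, rfl⟩⟩

theorem shift_pow {Φ : A α β →ₐ[k] Module.End k (ℕ → k)}
    (hΦ : ∀ f i, Φ (letter α β .x) f i = f (i + 1)) (r : ℕ) (f : ℕ → k) (i : ℕ) :
    Φ (letter α β .x ^ r) f i = f (i + r) := by
  induction r generalizing i with
  | zero => simp
  | succ r ih =>
    rw [pow_succ', map_mul, Module.End.mul_apply, hΦ, ih]
    congr 1
    ring

local notation "X" => letter α β Letter.x
local notation "Y" => letter α β Letter.y

theorem independent_x_y (hβ : β ≠ 0) {m : ℕ} {b b' : k}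
    (h : b • Y + b' • X ^ m = 0) : b = 0 ∧ b' = 0 := by
  obtain ⟨Φ, hΦ⟩ := exists_shift_x α β
  have key (f : ℕ → k) (i : ℕ) : b * (lam α β (i + 1) * f (i - 1)) + b' * f (i + m) = 0 := by
    have := congrFun (LinearMap.congr_fun (congrArg Φ h) f) i
    simpa only [map_add, map_smul, LinearMap.add_apply, LinearMap.smul_apply, Pi.add_apply,
      Pi.smul_apply, smul_eq_mul, hΦ, shift_pow (fun f i => (hΦ f i).1), map_zero,
      LinearMap.zero_apply, Pi.zero_apply] using this
  have h1 := key (fun _ => 1) 0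
  have h2 := key (fun _ => 1) 1
  have h3 : lam α β 1 = 0 := rfl
  have hb' : b' = 0 := by simpa [h3] using h1
  exact ⟨by simpa [hb', lam_two hβ] using h2, hb'⟩

/-- Where x is the shift, y vanishes at index 0, so evaluations at 0 and 1 on constant and delta
sequences isolate the first four words. For α = 0 every word beginning with yy acts there by 0,
since λ_i λ_{i-1} = 0; yyx is therefore detected where y is the shift. -/
theorem independent_xxy (hβ : β ≠ 0) {m : ℕ} {c₀ c₁ c₂ c₃ c₄ : k}
    (h : c₀ • X ^ (m + 2) + c₁ • (X * Y * X) + c₂ • (Y * X * X) + c₃ • (Y * X * Y) +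
      c₄ • (Y * Y * X) = 0) : c₀ = 0 ∧ c₁ = 0 ∧ c₂ = 0 ∧ c₃ = 0 ∧ c₄ = 0 := by
  have h3 : lam α β 1 = 0 := rfl
  have h4 := lam_two (α := α) hβ
  obtain ⟨Φ, hΦ⟩ := exists_shift_x α β
  have key (f : ℕ → k) (i : ℕ) := congrFun (LinearMap.congr_fun (congrArg Φ h) f) i
  simp only [map_add, map_smul, map_mul, LinearMap.add_apply, LinearMap.smul_apply,
    Module.End.mul_apply, Pi.add_apply, Pi.smul_apply, smul_eq_mul, hΦ,
    shift_pow (fun f i => (hΦ f i).1), map_zero, LinearMap.zero_apply, Pi.zero_apply] at key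
  obtain rfl : c₀ = 0 := by
    simpa [h3, Pi.single_apply] using key (Pi.single (m + 2) 1) 0
  obtain rfl : c₁ = 0 := by simpa [h3, h4] using key (fun _ => 1) 0
  obtain rfl : c₂ = 0 := by simpa [h3, h4, Pi.single_apply] using key (Pi.single 2 1) 1
  obtain rfl : c₃ = 0 := by simpa [h3, h4] using key (fun _ => 1) 1
  obtain ⟨Ψ, hΨ⟩ := exists_shift_y α β
  have key' := congrFun (LinearMap.congr_fun (congrArg Ψ h) fun _ => 1) 2
  simpa [hΨ, h4] using key'

theorem independent_xyy (hβ : β ≠ 0) {m : ℕ} {c₀ c₁ c₂ c₃ c₄ : k}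
    (h : c₀ • (Y * Y * Y) + c₁ • (Y * X * Y) + c₂ • (Y * Y * X) + c₃ • (Y * X ^ (m + 1)) +
      c₄ • (X * Y * X ^ m) = 0) : c₀ = 0 ∧ c₁ = 0 ∧ c₂ = 0 ∧ c₃ = 0 ∧ c₄ = 0 := by
  have h3 : lam α β 1 = 0 := rfl
  have h4 := lam_two (α := α) hβ
  obtain ⟨Φ, hΦ⟩ := exists_shift_x α β
  have key (f : ℕ → k) (i : ℕ) := congrFun (LinearMap.congr_fun (congrArg Φ h) f) i
  simp only [map_add, map_smul, map_mul, LinearMap.add_apply, LinearMap.smul_apply,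
    Module.End.mul_apply, Pi.add_apply, Pi.smul_apply, smul_eq_mul, hΦ,
    shift_pow (fun f i => (hΦ f i).1), map_zero, LinearMap.zero_apply, Pi.zero_apply] at key
  obtain rfl : c₄ = 0 := by simpa [h3, h4] using key (fun _ => 1) 0
  obtain rfl : c₃ = 0 := by
    simpa [h3, h4, Pi.single_apply, show m + 1 ≠ 0 by omega] using key (Pi.single (m + 1) 1) 1
  obtain rfl : c₁ = 0 := by simpa [h3, h4] using key (fun _ => 1) 1
  obtain ⟨Ψ, hΨ⟩ := exists_shift_y α β
  have key' (f : ℕ → k) (i : ℕ) := congrFun (LinearMap.congr_fun (congrArg Ψ h) f) i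
  obtain rfl : c₂ = 0 := by simpa [hΨ, h4] using key' (fun _ => 1) 2
  have key'' := key' (fun _ => 1) 3
  simpa [hΨ, h4] using key''

end DownUp

/-! ### The cocycle equations on coefficients -/

namespace DownUp

open Hoch

variable {k : Type u} [Field k] {n m : ℕ} {α β : k}

local notation "X" => letter α β Letter.x
local notation "Y" => letter α β Letter.y

/-- Left multiplication by x followed by the rewriting of x²y acts on the pair of coefficients by
the recursion of λ. -/
theorem x_pow_succ_mul_y (hβ : β ≠ 0) (r : ℕ) : X ^ (r + 1) * Y =
    lam α β (r + 2) • (X * Y * X ^ r) + (β * lam α β (r + 1)) • (Y * X ^ (r + 1)) := by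
  induction r with
  | zero => simp [lam_two hβ, show lam α β 1 = 0 from rfl]
  | succ r ih =>
    have h : X * (X * Y * X ^ r) = β • (Y * X ^ (r + 2)) + α • (X * Y * X ^ (r + 1)) := by
      rw [← mul_assoc, ← mul_assoc, letter_xxy, add_mul, smul_mul_assoc, smul_mul_assoc,
        pow_succ' _ (r + 1), pow_succ' _ r]
      simp only [mul_assoc]
    have h' : X ^ (r + 1 + 1) * Y = X * (X ^ (r + 1) * Y) := by rw [pow_succ', mul_assoc]
    rw [h', ih, mul_add, mul_smul_comm, mul_smul_comm, h,
      lam_succ_succ (r + 1), ← mul_assoc X Y]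
    module

theorem x_pow_mul_y_mul_x (hβ : β ≠ 0) (r : ℕ) : X ^ r * Y * X =
    lam α β (r + 1) • (X * Y * X ^ r) + (β * lam α β r) • (Y * X ^ (r + 1)) := by
  rcases r with _ | r
  -- For r = 0 the identity reads yx = λ_0 xy + βλ_{-1} yx, which is where λ_{-1} = β⁻¹ is used.
  · simp [lam, mul_inv_cancel₀ hβ]
  · rw [x_pow_succ_mul_y hβ, add_mul, smul_mul_assoc, smul_mul_assoc, mul_assoc _ _ X,
      mul_assoc _ _ X, ← pow_succ, ← pow_succ]

/-- The values with coefficients `a, a'` of `x, y` on the arrows `x_i`, and `b, b'` of `y, x ^ m` on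
the arrows `y_j`. -/
def values (α β : k) (m : ℕ) (a a' b b' : ℕ → k) : Letter → ℕ → A α β
  | .x, i => a i • letter α β .x + a' i • letter α β .y
  | .y, i => b i • letter α β .y + b' i • letter α β .x ^ m

/-- The defect of commutativity of the square with vertices `i, i + n, i + m, i + n + m`. -/
def curv (n m : ℕ) (a b : ℕ → k) (i : ℕ) : k := a i + b (i + n) - b i - a (i + m)

/-- The cocycle condition on the coefficients of the maps `x ↦ x` and `y ↦ y`. -/
def DiagCocycle (n m : ℕ) (α : k) (a b : ℕ → k) : Prop :=
  (∀ i < m, α * curv n m a b (i + n) = 0 ∧ curv n m a b i + curv n m a b (i + n) = 0) ∧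
    ∀ j < n, α * curv n m a b j = 0 ∧ curv n m a b j + curv n m a b (j + m) = 0

/-- The cocycle condition on the coefficients of the maps `x ↦ y`. -/
def XYCocycle (n m : ℕ) (α β : k) (a : ℕ → k) : Prop :=
  (∀ i < m, a i + α * a (i + n) = (α ^ 2 + β) * a (i + n + m) ∧
    β * a (i + n) = α * a i + α * β * a (i + n + m) + β * a (i + m)) ∧
    ∀ j < n, a j = α * a (j + m) + β * a (j + m + m)

/-- The cocycle condition on the coefficients of the maps `y ↦ x ^ m`. -/
def YXCocycle (n m : ℕ) (α β : k) (b : ℕ → k) : Prop :=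
  (∀ i < m, b (i + n + n) = α * b (i + n) + β * b i) ∧
    ∀ j < n, b (j + n) * lam α β (m + 2) + b (j + n + m) =
        b j * (α * lam α β (m + 2) + β * lam α β (m + 1)) ∧
      β * (b (j + n) * lam α β (m + 1)) = β * (b j * (α * lam α β (m + 1) + β * lam α β m)) +
        β * b (j + m) + α * b (j + n + m)

/-- In normal form the blocks meet different words: b' only x^{m+2}, a and b only xyx and yxx, a'
only yxy and yyx. Independence of these words separates the equations. -/
theorem compatible_x_iff (hβ : β ≠ 0) (a a' b b' : ℕ → k) (i : ℕ) :
    pathSum α β n m (values α β m a a' b b') .x .x .y i =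
      β • pathSum α β n m (values α β m a a' b b') .y .x .x i +
        α • pathSum α β n m (values α β m a a' b b') .x .y .x i ↔
    (α * curv n m a b (i + n) = 0 ∧ curv n m a b i + curv n m a b (i + n) = 0) ∧
    (a' i + α * a' (i + n) = (α ^ 2 + β) * a' (i + n + m) ∧
      β * a' (i + n) = α * a' i + α * β * a' (i + n + m) + β * a' (i + m)) ∧
    b' (i + n + n) = α * b' (i + n) + β * b' i := by
  have h1 : X * X * X ^ m = X ^ (m + 2) := by rw [mul_assoc, ← pow_succ', ← pow_succ']
  have h2 : X * X ^ m * X = X ^ (m + 2) := by rw [← pow_succ', ← pow_succ]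
  have h3 : X ^ m * X * X = X ^ (m + 2) := by rw [← pow_succ, ← pow_succ]
  have key : pathSum α β n m (values α β m a a' b b') .x .x .y i -
      (β • pathSum α β n m (values α β m a a' b b') .y .x .x i +
        α • pathSum α β n m (values α β m a a' b b') .x .y .x i) =
      (b' (i + n + n) - α * b' (i + n) - β * b' i) • X ^ (m + 2) +
      (α * curv n m a b (i + n)) • (X * Y * X) +
      (β * (curv n m a b i + curv n m a b (i + n))) • (Y * X * X) +
      (a' i + α * a' (i + n) - (α ^ 2 + β) * a' (i + n + m)) • (Y * X * Y) +
      (β * a' (i + n) - (α * a' i + α * β * a' (i + n + m) + β * a' (i + m))) • (Y * Y * X) := by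
    simp only [pathSum, values, weight, curv, mul_add, add_mul, smul_add, smul_mul_assoc,
      mul_smul_comm, letter_xxy, letter_xyy, h1, h2, h3, Nat.add_right_comm i m n]
    module
  rw [← sub_eq_zero, key]
  constructor
  · intro h
    obtain ⟨e0, e1, e2, e3, e4⟩ := independent_xxy hβ h
    refine ⟨⟨e1, (mul_eq_zero.1 e2).resolve_left hβ⟩, ⟨sub_eq_zero.1 e3, sub_eq_zero.1 e4⟩, ?_⟩
    linear_combination e0
  · rintro ⟨⟨e1, e2⟩, ⟨e3, e4⟩, e0⟩
    rw [e0, e1, e2, e3, e4]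
    module

/-- The same separation: a' meets yyy, the diagonal block yxy and yyx, and b' the words yx^{m+1} and
xyx^m, whose coefficients bring in the λ's. -/
theorem compatible_y_iff (hβ : β ≠ 0) (a a' b b' : ℕ → k) (j : ℕ) :
    pathSum α β n m (values α β m a a' b b') .x .y .y j =
      β • pathSum α β n m (values α β m a a' b b') .y .y .x j +
        α • pathSum α β n m (values α β m a a' b b') .y .x .y j ↔
    (α * curv n m a b j = 0 ∧ curv n m a b j + curv n m a b (j + m) = 0) ∧
    a' j = α * a' (j + m) + β * a' (j + m + m) ∧
    (b' (j + n) * lam α β (m + 2) + b' (j + n + m) =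
        b' j * (α * lam α β (m + 2) + β * lam α β (m + 1)) ∧
      β * (b' (j + n) * lam α β (m + 1)) = β * (b' j * (α * lam α β (m + 1) + β * lam α β m)) +
        β * b' (j + m) + α * b' (j + n + m)) := by
  have h1 : X * X ^ m * Y = X ^ (m + 1) * Y := by rw [pow_succ']
  have h2 : X ^ m * X * Y = X ^ (m + 1) * Y := by rw [pow_succ]
  have h3 : Y * X * X ^ m = Y * X ^ (m + 1) := by rw [pow_succ', mul_assoc]
  have h4 : Y * X ^ m * X = Y * X ^ (m + 1) := by rw [pow_succ, mul_assoc]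
  have key : pathSum α β n m (values α β m a a' b b') .x .y .y j -
      (β • pathSum α β n m (values α β m a a' b b') .y .y .x j +
        α • pathSum α β n m (values α β m a a' b b') .y .x .y j) =
      (a' j - (α * a' (j + m) + β * a' (j + m + m))) • (Y * Y * Y) +
      (α * curv n m a b j) • (Y * X * Y) +
      (β * (curv n m a b j + curv n m a b (j + m))) • (Y * Y * X) +
      (β * (b' (j + n) * lam α β (m + 1)) - (β * (b' j * (α * lam α β (m + 1) + β * lam α β m)) +
        β * b' (j + m) + α * b' (j + n + m))) • (Y * X ^ (m + 1)) +
      (b' (j + n) * lam α β (m + 2) + b' (j + n + m) -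
        b' j * (α * lam α β (m + 2) + β * lam α β (m + 1))) • (X * Y * X ^ m) := by
    simp only [pathSum, values, weight, curv, mul_add, add_mul, smul_add, smul_mul_assoc,
      mul_smul_comm, letter_xyy, x_pow_mul_y_mul_x hβ, x_pow_succ_mul_y hβ, h1, h2, h3, h4,
      Nat.add_right_comm j m n]
    module
  rw [← sub_eq_zero, key]
  constructor
  · intro h
    obtain ⟨e0, e1, e2, e3, e4⟩ := independent_xyy hβ h
    exact ⟨⟨e1, (mul_eq_zero.1 e2).resolve_left hβ⟩, sub_eq_zero.1 e0, sub_eq_zero.1 e4,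
      sub_eq_zero.1 e3⟩
  · rintro ⟨⟨e1, e2⟩, e0, e4, e3⟩
    rw [← e0, e1, e2, e3, e4]
    module

theorem compatible_iff (hβ : β ≠ 0) (a a' b b' : ℕ → k) :
    Compatible n m (values α β m a a' b b') ↔
      DiagCocycle n m α a b ∧ XYCocycle n m α β a' ∧ YXCocycle n m α β b' := by
  simp only [Compatible, compatible_x_iff hβ, compatible_y_iff hβ, DiagCocycle, XYCocycle,
    YXCocycle, imp_and, forall_and]
  tauto

end DownUp

namespace DownUp

open Hoch

variable {k : Type u} [Field k] {n m : ℕ} {α β : k}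

/-! ### Homogeneous components of small degree -/

/-- Since y alone has weight m and both weights are positive, a word of weight at most m that
contains y is y itself. -/
theorem word_of_weight_le (hn : 1 ≤ n) (hnm : n ≤ m) (w : List Letter)
    (hw : (w.map (weight n m)).sum ≤ m) : w = [.y] ∨ w = List.replicate w.length .x := by
  induction w with
  | nil => exact .inr rfl
  | cons c w ih =>
    rw [List.map_cons, List.sum_cons] at hw
    cases c
    · change n + _ ≤ m at hw
      rcases ih (by omega) with rfl | h
      · simp only [weight, List.map_cons, List.map_nil, List.sum_cons, List.sum_nil] at hw
        omega
      · exact .inr (by rw [List.length_cons, List.replicate_succ, ← h])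
    · left
      change m + _ ≤ m at hw
      rcases w with _ | ⟨c, w⟩
      · rfl
      · rw [List.map_cons, List.sum_cons] at hw
        cases c <;> simp only [weight] at hw <;> omega

theorem mem_comp_of_le (hn : 1 ≤ n) (hnm : n ≤ m) {d : ℕ} (hd : d ≤ m) {z : A α β}
    (hz : z ∈ comp n m α β d) : ∃ p q : k, z = p • letter α β .y + q • letter α β .x ^ (d / n) ∧
      (d = m ∨ p = 0) ∧ (n ∣ d ∨ q = 0) := by
  induction hz using Submodule.span_induction with
  | mem z h =>
    obtain ⟨w, rfl, rfl⟩ := h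
    rcases word_of_weight_le hn hnm w hd with rfl | h
    · exact ⟨1, 0, by simp, .inl (by simp [weight]), .inr rfl⟩
    · rw [h]
      refine ⟨0, 1, ?_, .inr rfl, .inl ?_⟩
      · simp [weight, Nat.mul_div_cancel _ hn]
      · simp [weight]
  | zero => exact ⟨0, 0, by simp, .inr rfl, .inr rfl⟩
  | add z z' _ _ h h' =>
    obtain ⟨p, q, rfl, hp, hq⟩ := h
    obtain ⟨p', q', rfl, hp', hq'⟩ := h'
    refine ⟨p + p', q + q', by module, ?_, ?_⟩
    · by_cases h : d = m
      · exact .inl h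
      · exact .inr (by rw [hp.resolve_left h, hp'.resolve_left h, add_zero])
    · by_cases h : n ∣ d
      · exact .inl h
      · exact .inr (by rw [hq.resolve_left h, hq'.resolve_left h, add_zero])
  | smul r z _ h =>
    obtain ⟨p, q, rfl, hp, hq⟩ := h
    exact ⟨r * p, r * q, by module, hp.imp_right fun h => by rw [h, mul_zero],
      hq.imp_right fun h => by rw [h, mul_zero]⟩

/-! ### Coefficients of cochains -/

/-- `f` has the coefficients `a, a'` of `x, y` on the arrows `x_i`, and `b, b'` of `y, x ^ m` on the
arrows `y_j`. -/
def HasCoeffs (f : Cochain n m α β) (a a' b b' : ℕ → k) : Prop :=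
  HasValues f (values α β m a a' b b')

theorem values_add (a a' b b' p p' q q' : ℕ → k) :
    values α β m (a + p) (a' + p') (b + q) (b' + q') =
      values α β m a a' b b' + values α β m p p' q q' := by
  funext c i
  cases c <;> simp only [values, Pi.add_apply] <;> module

theorem values_smul (r : k) (a a' b b' : ℕ → k) :
    values α β m (r • a) (r • a') (r • b) (r • b') = r • values α β m a a' b b' := by
  funext c i
  cases c <;> simp only [values, Pi.smul_apply, smul_eq_mul] <;> module

theorem HasCoeffs.add {f g : Cochain n m α β} {a a' b b' p p' q q' : ℕ → k}
    (hf : HasCoeffs f a a' b b') (hg : HasCoeffs g p p' q q') :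
    HasCoeffs (f + g) (a + p) (a' + p') (b + q) (b' + q') := by
  rw [HasCoeffs, values_add]
  exact HasValues.add hf hg

theorem HasCoeffs.smul {f : Cochain n m α β} {a a' b b' : ℕ → k} (r : k)
    (hf : HasCoeffs f a a' b b') : HasCoeffs (r • f) (r • a) (r • a') (r • b) (r • b') := by
  rw [HasCoeffs, values_smul]
  exact HasValues.smul r hf

theorem HasCoeffs.sub {f g : Cochain n m α β} {a a' b b' p p' q q' : ℕ → k}
    (hf : HasCoeffs f a a' b b') (hg : HasCoeffs g p p' q q') :
    HasCoeffs (f - g) (a - p) (a' - p') (b - q) (b' - q') := by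
  have h := hf.add (hg.smul (-1))
  have hfg : f + (-1 : k) • g = f - g := LinearMap.ext fun z => by
    rw [LinearMap.add_apply, LinearMap.smul_apply, neg_smul, one_smul, ← sub_eq_add_neg,
      LinearMap.sub_apply]
  simpa only [neg_smul, one_smul, ← sub_eq_add_neg, hfg] using h

theorem hasCoeffs_zero : HasCoeffs (0 : Cochain n m α β) 0 0 0 0 := fun h => by
  have h0 : values α β m 0 0 0 0 (lab h) (src h) = 0 := by cases lab h <;> simp [values]
  rw [h0, Matrix.single_zero]
  rfl

theorem HasCoeffs.sum {ι : Type*} (s : Finset ι) {f : ι → Cochain n m α β}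
    {a a' b b' : ι → ℕ → k} (hf : ∀ i, HasCoeffs (f i) (a i) (a' i) (b i) (b' i)) :
    HasCoeffs (∑ i ∈ s, f i) (∑ i ∈ s, a i) (∑ i ∈ s, a' i) (∑ i ∈ s, b i) (∑ i ∈ s, b' i) := by
  classical
  induction s using Finset.induction_on with
  | empty => exact hasCoeffs_zero
  | insert i s hi ih =>
    simp only [Finset.sum_insert hi]
    exact (hf i).add ih

theorem HasCoeffs.congr {f : Cochain n m α β} {a a' b b' p p' q q' : ℕ → k}
    (hf : HasCoeffs f a a' b b') (ha : ∀ i < n + 2 * m, a i = p i)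
    (ha' : ∀ i < n + 2 * m, a' i = p' i) (hb : ∀ j < 2 * n + m, b j = q j)
    (hb' : ∀ j < 2 * n + m, b' j = q' j) : HasCoeffs f p p' q q' := fun h => by
  rw [hf h]
  rcases h with i | j
  · simp only [lab, src, values, ha i i.2, ha' i i.2]
  · simp only [lab, src, values, hb j j.2, hb' j j.2]

theorem HasCoeffs.unique (hβ : β ≠ 0) {f : Cochain n m α β} {a a' b b' p p' q q' : ℕ → k}
    (hf : HasCoeffs f a a' b b') (hg : HasCoeffs f p p' q q') :
    (∀ i < n + 2 * m, a i = p i ∧ a' i = p' i) ∧ ∀ j < 2 * n + m, b j = q j ∧ b' j = q' j := by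
  have key (h : Arrow n m) : values α β m a a' b b' (lab h) (src h) =
      values α β m p p' q q' (lab h) (src h) := by
    rw [← Matrix.single_apply_same (src h) (tgt h) (values α β m a a' b b' (lab h) (src h)),
      ← Matrix.single_apply_same (src h) (tgt h) (values α β m p p' q q' (lab h) (src h)),
      ← hf h, ← hg h]
  refine ⟨fun i hi => ?_, fun j hj => ?_⟩
  · have h := key (.inl ⟨i, hi⟩)
    simp only [lab, src, values] at h
    have := independent_x_y (m := 1) (b := a' i - p' i) (b' := a i - p i) hβ (by
      rw [pow_one, sub_smul, sub_smul, ← sub_eq_zero.2 h]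
      abel)
    exact ⟨sub_eq_zero.1 this.2, sub_eq_zero.1 this.1⟩
  · have h := key (.inr ⟨j, hj⟩)
    simp only [lab, src, values] at h
    have := independent_x_y (m := m) (b := b j - q j) (b' := b' j - q' j) hβ (by
      rw [sub_smul, sub_smul, ← sub_eq_zero.2 h]
      abel)
    exact ⟨sub_eq_zero.1 this.1, sub_eq_zero.1 this.2⟩

/-- A power of x lies in A_m only if n divides m, that is n = 1 by coprimality; y lies in A_n only
if n = m, which then forces both to be 1. -/
theorem exists_hasCoeffs (hn : 1 ≤ n) (hnm : n ≤ m) (hcop : Nat.Coprime n m)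
    (f : Cochain n m α β) : ∃ a a' b b', HasCoeffs f a a' b b' ∧
      ((n = 1 ∧ m = 1) ∨ a' = 0) ∧ (n = 1 ∨ b' = 0) := by
  obtain ⟨v, hv, hmem⟩ := exists_hasValues f
  choose a' a hx ha' _ using fun i => mem_comp_of_le hn hnm hnm (hmem .x i)
  choose b b' hy _ hb' using fun i => mem_comp_of_le hn hnm le_rfl (hmem .y i)
  have hdvd : n ∣ m → n = 1 := fun h => by rwa [Nat.Coprime, Nat.gcd_eq_left h] at hcop
  refine ⟨a, a', b, b', fun h => (hv h).trans ?_, ?_, ?_⟩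
  · congr 1
    rcases h with i | j
    · change v .x i = a i • letter α β .x + a' i • letter α β .y
      rw [hx i]
      rw [Nat.div_self hn, pow_one, add_comm]
    · change v .y j = b j • letter α β .y + b' j • letter α β .x ^ m
      rw [hy j]
      rcases hb' j with h | h
      · rw [show m / n = m by rw [hdvd h, Nat.div_one]]
      · rw [h, zero_smul, zero_smul]
  · by_cases h : n = m
    · subst h
      have h1 := hdvd dvd_rfl
      exact .inl ⟨h1, h1⟩
    · exact .inr (funext fun i => (ha' i).resolve_left h)
  · by_cases h : n ∣ m
    · exact .inl (hdvd h)
    · exact .inr (funext fun j => (hb' j).resolve_left h)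

/-- As A_0 = k, a bimodule map on P⁰ is one scalar per vertex, and its coboundary rescales each
arrow by a difference. -/
theorem isCoboundary_iff_exists (hn : 1 ≤ n) (hnm : n ≤ m) {f : Cochain n m α β} :
    IsCoboundary n m α β f ↔ ∃ c : ℕ → k,
      HasCoeffs f (fun i => c i - c (i + n)) 0 (fun j => c j - c (j + m)) 0 := by
  have hval {φ : P0 k (idem n m α β) →ₗ[Env k (NablaA n m α β)] NablaA n m α β} {c : ℕ → k}
      (hφ : ∀ i, φ (gen k _ _ i) = c i • idem n m α β i) :
      HasCoeffs (φ ∘ₗ D1 n m α β) (fun i => c i - c (i + n)) 0 (fun j => c j - c (j + m)) 0 := by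
    intro h
    have h1 : (φ ∘ₗ D1 n m α β) (gen k _ _ h) = (c (src h) - c (tgt h)) • arr α β h := by
      rw [LinearMap.comp_apply, D1, d1_gen idem_mul_idem idem_mul_arr arr_mul_idem, map_sub,
        map_smul, map_smul, hφ, hφ, act_smul, act_smul, one_mul, mul_one, smul_mul_assoc,
        mul_smul_comm, idem_mul_arr, arr_mul_idem, sub_smul]
    rw [h1]
    change _ • Matrix.single _ _ _ = _
    rw [Matrix.smul_single]
    congr 1
    rcases h with i | j <;> simp [lab, values, src, tgt]
  constructor
  · rintro ⟨φ, rfl⟩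
    have hc (i : Fin (2 * (n + m))) : ∃ c : k, φ (gen k _ _ i) = c • idem n m α β i := by
      have hmem := (φ (gen k _ _ i)).2 i i
      rw [entry, if_pos le_rfl, Nat.sub_self] at hmem
      obtain ⟨p, q, hpq, hp, -⟩ := mem_comp_of_le hn hnm (Nat.zero_le m) hmem
      rw [hp.resolve_left (by omega), zero_smul, zero_add, Nat.zero_div, pow_zero] at hpq
      refine ⟨q, Subtype.ext ?_⟩
      have h1 : idem n m α β i * φ (gen k _ _ i) * idem n m α β i = φ (gen k _ _ i) := by
        rw [← act_smul (k := k), ← map_smul, act_smul_gen idem_mul_idem idem_mul_idem]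
      rw [← h1]
      refine (Matrix.single_mul_mul_single _ _ _ _ _ _ _).trans ?_
      rw [hpq, one_mul, mul_one, ← Matrix.smul_single]
      rfl
    choose c hc using hc
    refine ⟨fun i => if h : i < 2 * (n + m) then c ⟨i, h⟩ else 0, hval fun i => ?_⟩
    rw [hc, dif_pos i.2]
  · rintro ⟨c, hc⟩
    refine ⟨ofGens k _ _ fun i => c i • idem n m α β i, HasValues.ext hc (hval fun i => ?_)⟩
    rw [ofGens_gen, act_smul, mul_smul_comm, smul_mul_assoc, idem_mul_idem, idem_mul_idem]

/-- The coefficients of the maps `x ↦ x` and `y ↦ y` are those of a coboundary. -/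
def DiagBoundary (n m : ℕ) (a b : ℕ → k) : Prop :=
  ∃ c : ℕ → k, (∀ i < n + 2 * m, a i = c i - c (i + n)) ∧
    ∀ j < 2 * n + m, b j = c j - c (j + m)

theorem HasCoeffs.isCoboundary_iff (hn : 1 ≤ n) (hnm : n ≤ m) (hβ : β ≠ 0)
    {f : Cochain n m α β} {a a' b b' : ℕ → k} (hf : HasCoeffs f a a' b b') :
    IsCoboundary n m α β f ↔ DiagBoundary n m a b ∧ (∀ i < n + 2 * m, a' i = 0) ∧
      ∀ j < 2 * n + m, b' j = 0 := by
  rw [isCoboundary_iff_exists hn hnm]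
  constructor
  · rintro ⟨c, hc⟩
    obtain ⟨h1, h2⟩ := hf.unique hβ hc
    exact ⟨⟨c, fun i hi => (h1 i hi).1, fun j hj => (h2 j hj).1⟩, fun i hi => (h1 i hi).2,
      fun j hj => (h2 j hj).2⟩
  · rintro ⟨⟨c, h1, h2⟩, h3, h4⟩
    exact ⟨c, hf.congr h1 h3 h2 h4⟩

theorem HasCoeffs.cocycle_iff (hβ : β ≠ 0) {f : Cochain n m α β} {a a' b b' : ℕ → k}
    (hf : HasCoeffs f a a' b b') : f ∘ₗ D2 n m α β = 0 ↔
      DiagCocycle n m α a b ∧ XYCocycle n m α β a' ∧ YXCocycle n m α β b' :=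
  (DownUp.cocycle_iff hf).trans (compatible_iff hβ a a' b b')

/-- Reduces the theorem to linear algebra on sequences. Off the diagonal block there are no
coboundaries, so equality is demanded there, on the indices of actual arrows only. -/
theorem isHHBasis_of_hasCoeffs (hn : 1 ≤ n) (hnm : n ≤ m) (hcop : Nat.Coprime n m) (hβ : β ≠ 0)
    {N : ℕ} {f : Fin N → Cochain n m α β} {a a' b b' : Fin N → ℕ → k}
    (hf : ∀ i, HasCoeffs (f i) (a i) (a' i) (b i) (b' i))
    (hcoc : ∀ i, DiagCocycle n m α (a i) (b i) ∧ XYCocycle n m α β (a' i) ∧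
      YXCocycle n m α β (b' i))
    (hli : ∀ c : Fin N → k, DiagBoundary n m (∑ i, c i • a i) (∑ i, c i • b i) →
      (∀ p < n + 2 * m, (∑ i, c i • a' i) p = 0) → (∀ p < 2 * n + m, (∑ i, c i • b' i) p = 0) →
      c = 0)
    (hspan : ∀ p p' q q' : ℕ → k, DiagCocycle n m α p q → XYCocycle n m α β p' →
      YXCocycle n m α β q' → ((n = 1 ∧ m = 1) ∨ p' = 0) → (n = 1 ∨ q' = 0) →
      ∃ c : Fin N → k, DiagBoundary n m (p - ∑ i, c i • a i) (q - ∑ i, c i • b i) ∧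
        (∀ r < n + 2 * m, p' r = (∑ i, c i • a' i) r) ∧
        ∀ r < 2 * n + m, q' r = (∑ i, c i • b' i) r) : IsHHBasis n m α β f := by
  have hsum (c : Fin N → k) := HasCoeffs.sum Finset.univ fun i => (hf i).smul (c i)
  refine isHHBasis_of (fun i => ((hf i).cocycle_iff hβ).2 (hcoc i)) (fun c hc => ?_) fun g hg => ?_
  · obtain ⟨h1, h2, h3⟩ := ((hsum c).isCoboundary_iff hn hnm hβ).1 hc
    exact hli c h1 h2 h3
  · obtain ⟨p, p', q, q', hpq, h1, h2⟩ := exists_hasCoeffs hn hnm hcop g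
    obtain ⟨h3, h4, h5⟩ := (hpq.cocycle_iff hβ).1 hg
    obtain ⟨c, h6, h7, h8⟩ := hspan p p' q q' h3 h4 h5 h1 h2
    exact ⟨c, ((hpq.sub (hsum c)).isCoboundary_iff hn hnm hβ).2
      ⟨h6, fun r hr => sub_eq_zero.2 (h7 r hr), fun r hr => sub_eq_zero.2 (h8 r hr)⟩⟩

/-! ### Coefficients of the listed cochains -/

theorem hasValues_tau (h : Arrow n m) (z : A α β) (hz : z ∈ comp n m α β (weight n m (lab h)))
    {v : Letter → ℕ → A α β} (hv : ∀ h', v (lab h') (src h') = if h' = h then z else 0) :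
    HasValues (tau α β h z hz) v := fun h' => by
  have h1 : tau α β h z hz (gen k _ _ h') =
      if h' = h then elt (src h) (tgt h) (tgt_eq h) z hz else 0 := by
    rw [tau, cochain, ofGens_gen]
    split_ifs with hh
    · subst hh
      rw [act_smul, idem_mul_elt, elt_mul_idem]
    · rw [smul_zero]
  rw [h1, hv]
  split_ifs with hh
  · subst hh
    rfl
  · rw [Matrix.single_zero]
    rfl

theorem hasCoeffs_tauX (i : Fin (n + 2 * m)) :
    HasCoeffs (tauX α β i : Cochain n m α β) (Pi.single i 1) 0 0 0 := by
  refine hasValues_tau _ _ _ fun h => ?_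
  rcases h with p | p
  · by_cases hp : p = i
    · simp [values, lab, src, hp]
    · simp [values, lab, src, hp, Fin.val_inj]
  · simp [values, lab]

theorem hasCoeffs_tauYX (hn : n = 1) (j : Fin (2 * n + m)) :
    HasCoeffs (tauYX α β hn j : Cochain n m α β) 0 0 0 (Pi.single j 1) := by
  refine hasValues_tau _ _ _ fun h => ?_
  rcases h with p | p
  · simp [values, lab]
  · by_cases hp : p = j
    · simp [values, lab, src, hp]
    · simp [values, lab, src, hp, Fin.val_inj]

theorem hasCoeffs_tauXY (hn : n = 1) (hm : m = 1) (i : Fin (n + 2 * m)) :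
    HasCoeffs (tauXY α β hn hm i : Cochain n m α β) 0 (Pi.single i 1) 0 0 := by
  refine hasValues_tau _ _ _ fun h => ?_
  rcases h with p | p
  · by_cases hp : p = i
    · simp [values, lab, src, hp]
    · simp [values, lab, src, hp, Fin.val_inj]
  · simp [values, lab]

theorem sum_fin_smul_single {N : ℕ} (r : ℕ → k) {p : ℕ} (hp : p < N) :
    (∑ i : Fin N, r i • (Pi.single (i : ℕ) 1 : ℕ → k)) p = r p := by
  rw [Finset.sum_apply, Finset.sum_eq_single ⟨p, hp⟩]
  · simp
  · intro i _ hi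
    have : p ≠ i := fun h => hi (Fin.ext h.symm)
    simp [this]
  · simp

theorem hasCoeffs_sumX : HasCoeffs (sumX α β : Cochain n m α β) 1 0 0 0 := by
  refine (HasCoeffs.sum Finset.univ hasCoeffs_tauX).congr (fun p hp => ?_) (by simp) (by simp)
    (by simp)
  simpa using sum_fin_smul_single (fun _ => (1 : k)) hp

/-- The coefficients of the alternating sum. -/
def altCoeff (k : Type u) [Field k] (n m : ℕ) (i : ℕ) : k :=
  if n ≤ i ∧ i < n + m then (-1) ^ (i - n) else 0

theorem hasCoeffs_altX : HasCoeffs (altX α β : Cochain n m α β) (altCoeff k n m) 0 0 0 := by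
  refine (HasCoeffs.sum Finset.univ fun r : Fin m => (hasCoeffs_tauX (⟨n + r, by omega⟩ :
    Fin (n + 2 * m))).smul ((-1 : k) ^ (r : ℕ))).congr (fun p hp => ?_) (by simp) (by simp)
    (by simp)
  rw [altCoeff, Finset.sum_apply]
  split_ifs with h
  · rw [Finset.sum_eq_single ⟨p - n, by omega⟩]
    · simp [Nat.add_sub_cancel' h.1]
    · intro r _ hr
      have : p ≠ n + r := fun h => hr (Fin.ext (by simp; omega))
      simp [this]
    · simp
  · refine Finset.sum_eq_zero fun r _ => ?_
    have : p ≠ n + r := by omega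
    simp [this]

theorem hasCoeffs_sum_tauYX (hn : n = 1) (r : ℕ → k) :
    HasCoeffs (∑ j : Fin (2 * n + m), r j • tauYX α β hn j : Cochain n m α β) 0 0 0 r := by
  refine (HasCoeffs.sum Finset.univ fun j => (hasCoeffs_tauYX hn j).smul (r j)).congr
    (by simp) (by simp) (by simp) fun p hp => sum_fin_smul_single r hp

end DownUp

/-! ### Potentials on a cycle -/

theorem ZMod.sum_val {M : Type*} [AddCommMonoid M] (N : ℕ) [NeZero N] (f : ℕ → M) :
    ∑ z : ZMod N, f z.val = ∑ i ∈ Finset.range N, f i := by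
  obtain ⟨N, rfl⟩ := Nat.exists_eq_succ_of_ne_zero (NeZero.ne N)
  exact Fin.sum_univ_eq_sum_range f (N + 1)

/-- A function on a cycle with sum zero is a difference. -/
theorem ZMod.exists_sub_eq {M : Type*} [AddCommGroup M] {N : ℕ} [NeZero N] (g : (ZMod N)ˣ)
    (d : ZMod N → M) (hd : ∑ z, d z = 0) : ∃ c : ZMod N → M, ∀ z, c z - c (z + g) = d z := by
  -- Reordering along multiples of the unit g reduces to steps of length 1, where negated partial
  -- sums are a potential.
  set d' : ℕ → M := fun u => d (u * g) with hd'
  have hd0 : ∑ u ∈ Finset.range N, d' u = 0 := by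
    rw [← ZMod.sum_val N d', ← hd, ← Equiv.sum_comp (Units.mulRight g) d]
    simp [hd']
  set c' : ZMod N → M := fun z => -∑ u ∈ Finset.range z.val, d' u with hc'
  have hc (z : ZMod N) : c' z - c' (z + 1) = d' z.val := by
    have hz := ZMod.val_lt z
    rcases (Nat.succ_le_of_lt hz).lt_or_eq with h | h
    · have h1 : (z + 1).val = z.val + 1 := by
        rw [ZMod.val_add, ZMod.val_one_eq_one_mod, Nat.add_mod_mod, Nat.mod_eq_of_lt h]
      rw [hc']
      simp only [h1, Finset.sum_range_succ]
      abel
    -- The step that closes the cycle; only here is the vanishing of the total sum used.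
    · have h1 : (z + 1).val = 0 := by
        rw [ZMod.val_add, ZMod.val_one_eq_one_mod, Nat.add_mod_mod]
        change z.val.succ % N = 0
        rw [h, Nat.mod_self]
      rw [← h, Finset.sum_range_succ] at hd0
      rw [hc']
      simp only [h1, Finset.sum_range_zero]
      rw [eq_neg_of_add_eq_zero_left hd0]
      abel
  refine ⟨fun z => c' (z * ↑g⁻¹), fun z => ?_⟩
  beta_reduce
  rw [add_mul, Units.mul_inv, hc, hd']
  simp

namespace DownUp

variable {k : Type u} [Field k] {n m : ℕ}

/-! ### The maps `x ↦ x` and `y ↦ y` -/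

/-- Since n = -m in ℤ/(n+m), translation by n follows x_i forwards when i < m and y_{i-m} backwards
otherwise: the cycle on the first n + m vertices. -/
theorem val_add_natCast (hm : 0 < m) [NeZero (n + m)] (z : ZMod (n + m)) :
    (z + (n : ZMod (n + m))).val = if z.val < m then z.val + n else z.val - m := by
  have hz := ZMod.val_lt z
  rw [ZMod.val_add, ZMod.val_natCast, Nat.add_mod_mod]
  split_ifs with h
  · exact Nat.mod_eq_of_lt (by omega)
  · rw [Nat.mod_eq_sub_mod (by omega), Nat.mod_eq_of_lt (by omega)]
    omega

theorem curv_add (a b p q : ℕ → k) (i : ℕ) :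
    curv n m (a + p) (b + q) i = curv n m a b i + curv n m p q i := by
  simp only [curv, Pi.add_apply]
  ring

theorem curv_smul (r : k) (a b : ℕ → k) (i : ℕ) :
    curv n m (r • a) (r • b) i = r * curv n m a b i := by
  simp only [curv, Pi.smul_apply, smul_eq_mul]
  ring

theorem curv_one (i : ℕ) : curv n m (1 : ℕ → k) 0 i = 0 := by simp [curv]

theorem DiagBoundary.curv_eq_zero {a b : ℕ → k} (h : DiagBoundary n m a b) {i : ℕ}
    (hi : i < n + m) : curv n m a b i = 0 := by
  obtain ⟨c, h1, h2⟩ := h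
  rw [curv, h1 i (by omega), h1 (i + m) (by omega), h2 i (by omega), h2 (i + n) (by omega),
    Nat.add_right_comm i m n]
  ring

/-- The two sums are the x-part and the y-part of the holonomy around that cycle, which a potential
makes cancel. -/
theorem DiagBoundary.sum_eq {a b : ℕ → k} (h : DiagBoundary n m a b) :
    ∑ i ∈ Finset.range m, a i = ∑ j ∈ Finset.range n, b j := by
  obtain ⟨c, h1, h2⟩ := h
  rw [Finset.sum_congr rfl fun i hi => h1 i (by rw [Finset.mem_range] at hi; omega),
    Finset.sum_congr rfl fun j hj => h2 j (by rw [Finset.mem_range] at hj; omega),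
    Finset.sum_sub_distrib, Finset.sum_sub_distrib]
  have e1 := Finset.sum_range_add c n m
  have e2 := Finset.sum_range_add c m n
  rw [add_comm m n] at e2
  simp only [add_comm _ n, add_comm _ m]
  linear_combination e1 - e2

theorem not_diagBoundary_smul_one [CharZero k] (hm : 0 < m) {s : k}
    (h : DiagBoundary n m (s • (1 : ℕ → k)) 0) : s = 0 := by
  have h1 := h.sum_eq
  simp only [Pi.smul_apply, Pi.one_apply, smul_eq_mul, mul_one, Finset.sum_const,
    Finset.card_range, nsmul_eq_mul, Pi.zero_apply, mul_zero] at h1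
  exact (mul_eq_zero.1 h1).resolve_left (Nat.cast_ne_zero.2 hm.ne')

/-- Extends a potential from `[0, N)` along the arrows `y_j`. -/
def extendPotential (N m : ℕ) (c b : ℕ → k) (v : ℕ) : k :=
  if _h : v < N ∨ m = 0 ∨ v < m then c v else extendPotential N m c b (v - m) - b (v - m)
termination_by v
decreasing_by omega

/-- A flat cochain with holonomy zero along the cycle of the first `n + m` vertices is a
coboundary. -/
theorem diagBoundary_of_curv_eq_zero (hm : 0 < m) (hcop : Nat.Coprime n m) {a b : ℕ → k}
    (hflat : ∀ i < n + m, curv n m a b i = 0)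
    (hsum : ∑ i ∈ Finset.range m, a i = ∑ j ∈ Finset.range n, b j) : DiagBoundary n m a b := by
  have : NeZero (n + m) := ⟨by omega⟩
  -- The increment along the cycle, with a sign where an arrow y is traversed backwards.
  set d : ℕ → k := fun i => if i < m then a i else -b (i - m) with hd
  obtain ⟨c₀, hc₀⟩ := ZMod.exists_sub_eq (ZMod.unitOfCoprime n
    (by simpa using hcop : Nat.Coprime n (n + m))) (fun z => d z.val) (by
      rw [ZMod.sum_val (n + m) d, add_comm n m, Finset.sum_range_add,
        Finset.sum_congr rfl fun i hi => if_pos (Finset.mem_range.1 hi), hsum,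
        ← Finset.sum_add_distrib]
      exact Finset.sum_eq_zero fun j _ => by simp [hd])
  simp only [ZMod.coe_unitOfCoprime] at hc₀
  set c := extendPotential (n + m) m (fun i => c₀ i) b with hc
  have hlt (v : ℕ) (hv : v < n + m) : c v = c₀ v := by
    rw [hc, extendPotential, dif_pos (.inl hv)]
  have hcyc (i : ℕ) (hi : i < n + m) : c i - c (if i < m then i + n else i - m) = d i := by
    have h1 := hc₀ i
    have h2 := val_add_natCast hm (i : ZMod (n + m))
    rw [ZMod.val_cast_of_lt hi] at h1 h2
    rw [hlt i hi, hlt _ (by split_ifs <;> omega), ← h2, ZMod.natCast_zmod_val, h1]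
  have hb (j : ℕ) : j < 2 * n + m → b j = c j - c (j + m) := fun hj => by
    by_cases h : j < n
    · have h1 := hcyc (j + m) (by omega)
      simp only [hd, show ¬ j + m < m by omega, if_false, Nat.add_sub_cancel] at h1
      linear_combination h1
    · have h1 : c (j + m) = c j - b j := by
        rw [hc, extendPotential, dif_neg (by omega), Nat.add_sub_cancel]
      rw [h1, sub_sub_cancel]
  refine ⟨c, fun i => ?_, hb⟩
  induction i using Nat.strong_induction_on with
  | _ i ih =>
    intro hi
    by_cases h : i < m
    · have h1 := hcyc i (by omega)
      simp only [hd, h, if_true] at h1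
      exact h1.symm
    -- The potential was extended along the y-arrows alone; flatness of the square at p = i - m
    -- carries the equation from x_p to x_{p+m}.
    · obtain ⟨p, rfl⟩ := Nat.exists_eq_add_of_le' (not_lt.1 h)
      have h1 := hflat p (by omega)
      rw [curv, ih p (by omega) (by omega), hb p (by omega), hb (p + n) (by omega)] at h1
      rw [Nat.add_right_comm p m n]
      linear_combination -h1

theorem exists_diagBoundary_sub [CharZero k] (hm : 0 < m) (hcop : Nat.Coprime n m) {a b : ℕ → k}
    (hflat : ∀ i < n + m, curv n m a b i = 0) :
    ∃ s : k, DiagBoundary n m (a - s • (1 : ℕ → k)) b := by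
  have hm0 : (m : k) ≠ 0 := Nat.cast_ne_zero.2 hm.ne'
  -- The holonomy divided by that of the constant cochain 1, which is m.
  refine ⟨(∑ i ∈ Finset.range m, a i - ∑ j ∈ Finset.range n, b j) / m,
    diagBoundary_of_curv_eq_zero hm hcop (fun i hi => ?_) ?_⟩
  · rw [← hflat i hi]
    simp only [curv, Pi.sub_apply, Pi.smul_apply, Pi.one_apply]
    ring
  · simp only [Pi.sub_apply, Pi.smul_apply, Pi.one_apply, smul_eq_mul, mul_one,
      Finset.sum_sub_distrib, Finset.sum_const, Finset.card_range, nsmul_eq_mul]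
    rw [mul_div_cancel₀ _ hm0]
    ring

theorem diagCocycle_of_curv_eq_zero {α : k} {a b : ℕ → k}
    (h : ∀ i < n + m, curv n m a b i = 0) : DiagCocycle n m α a b :=
  ⟨fun i hi => by rw [h i (by omega), h (i + n) (by omega)]; simp,
    fun j hj => by rw [h j (by omega), h (j + m) (by omega)]; simp⟩

/-- Translation by n on ℤ/(n+m) flips the sign of the curvature: the f-relations say so for residues
below m, the g-relations for the others. -/
theorem DiagCocycle.curv_mul (hm : 0 < m) {α : k} {a b : ℕ → k} (h : DiagCocycle n m α a b)
    (t : ℕ) : curv n m a b (t * n % (n + m)) = (-1) ^ t * curv n m a b 0 := by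
  have : NeZero (n + m) := ⟨by omega⟩
  rw [← ZMod.val_natCast, Nat.cast_mul]
  induction t with
  | zero => simp
  | succ t ih =>
    have hz := ZMod.val_lt (t * n : ZMod (n + m))
    rw [Nat.cast_succ, add_mul, one_mul, val_add_natCast hm, pow_succ, mul_neg_one, neg_mul, ← ih]
    generalize (t * n : ZMod (n + m)).val = z at hz ⊢
    split_ifs with hzm
    · linear_combination (h.1 z hzm).2
    · have h1 := (h.2 (z - m) (by omega)).2
      rw [Nat.sub_add_cancel (not_lt.1 hzm)] at h1
      linear_combination h1

theorem exists_mul_mod_eq (hcop : Nat.Coprime n m) {i : ℕ} (hi : i < n + m) :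
    ∃ t : ℕ, i = t * n % (n + m) := by
  have : NeZero (n + m) := ⟨by omega⟩
  set g := ZMod.unitOfCoprime n (by simpa using hcop : Nat.Coprime n (n + m))
  have hgn : (g : ZMod (n + m)) = n := ZMod.coe_unitOfCoprime _ _
  refine ⟨((i : ZMod (n + m)) * ↑g⁻¹).val, ?_⟩
  rw [← ZMod.val_natCast, Nat.cast_mul, ZMod.natCast_zmod_val, ← hgn, mul_assoc, Units.inv_mul,
    mul_one, ZMod.val_cast_of_lt hi]

theorem DiagCocycle.curv_eq_zero [CharZero k] (hm : 0 < m) (hcop : Nat.Coprime n m) {α : k}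
    {a b : ℕ → k} (h : DiagCocycle n m α a b) (hI : ¬ CaseI n m α) {i : ℕ} (hi : i < n + m) :
    curv n m a b i = 0 := by
  by_cases hα : α = 0
  · have hodd : Odd (n + m) := Nat.not_even_iff_odd.1 fun he => hI ⟨he, hα⟩
    have h0 : curv n m a b 0 = 0 := by
      -- One full turn around a cycle of odd length gives curv 0 = -curv 0.
      have h1 := h.curv_mul hm (n + m)
      rw [Nat.mul_mod_right, hodd.neg_one_pow] at h1
      have h2 : (2 : k) * curv n m a b 0 = 0 := by linear_combination h1
      exact (mul_eq_zero.1 h2).resolve_left two_ne_zero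
    obtain ⟨t, rfl⟩ := exists_mul_mod_eq hcop hi
    rw [h.curv_mul hm, h0, mul_zero]
  · by_cases hin : i < n
    · exact (mul_eq_zero.1 (h.2 i hin).1).resolve_left hα
    · have h1 := (h.1 (i - n) (by omega)).1
      rw [Nat.sub_add_cancel (not_lt.1 hin)] at h1
      exact (mul_eq_zero.1 h1).resolve_left hα

theorem odd_of_even_add (hcop : Nat.Coprime n m) (he : Even (n + m)) : Odd n ∧ Odd m := by
  rcases Nat.even_or_odd n with h | h
  · have h2 := Nat.dvd_gcd h.two_dvd ((Nat.even_add.1 he).1 h).two_dvd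
    rw [hcop] at h2
    omega
  · exact ⟨h, Nat.not_even_iff_odd.1 fun hm => Nat.not_even_iff_odd.2 h ((Nat.even_add.1 he).2 hm)⟩

theorem neg_one_pow_congr {p q : ℕ} (h : p % 2 = q % 2) : (-1 : k) ^ p = (-1) ^ q := by
  rw [neg_one_pow_eq_pow_mod_two, h, ← neg_one_pow_eq_pow_mod_two]

/-- Exactly one of the x-sides i and i + m of the square lies in the support [n, n+m), and as n and
m are odd both possibilities give the same sign. -/
theorem curv_altCoeff (hnm : n ≤ m) (hcop : Nat.Coprime n m) (he : Even (n + m)) {i : ℕ}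
    (hi : i < n + m) : curv n m (altCoeff k n m) 0 i = -(-1) ^ i := by
  obtain ⟨h1, h2⟩ := odd_of_even_add hcop he
  rw [Nat.odd_iff] at h1 h2
  rw [curv, altCoeff, altCoeff, Pi.zero_apply, Pi.zero_apply]
  by_cases h : i < n
  · rw [if_neg (by omega), if_pos (by omega), neg_one_pow_congr (q := i) (by omega)]
    ring
  · rw [if_pos (by omega), if_neg (by omega), neg_one_pow_congr (q := i + 1) (by omega)]
    ring

theorem diagCocycle_altCoeff (hnm : n ≤ m) (hcop : Nat.Coprime n m) {α : k}
    (hI : CaseI n m α) : DiagCocycle n m α (altCoeff k n m) 0 := by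
  obtain ⟨he, rfl⟩ := hI
  obtain ⟨h1, h2⟩ := odd_of_even_add hcop he
  refine ⟨fun i hi => ⟨zero_mul _, ?_⟩, fun j hj => ⟨zero_mul _, ?_⟩⟩
  · rw [curv_altCoeff hnm hcop he (by omega), curv_altCoeff hnm hcop he (by omega), pow_add,
      h1.neg_one_pow]
    ring
  · rw [curv_altCoeff hnm hcop he (by omega), curv_altCoeff hnm hcop he (by omega), pow_add,
      h2.neg_one_pow]
    ring

theorem exists_diagBoundary_of_not_caseI [CharZero k] (hm : 0 < m) (hcop : Nat.Coprime n m) {α : k}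
    {a b : ℕ → k} (h : DiagCocycle n m α a b) (hI : ¬ CaseI n m α) :
    ∃ s : k, DiagBoundary n m (a - s • (1 : ℕ → k)) b :=
  exists_diagBoundary_sub hm hcop fun _ hi => h.curv_eq_zero hm hcop hI hi

theorem exists_diagBoundary_of_caseI [CharZero k] (hm : 0 < m) (hnm : n ≤ m)
    (hcop : Nat.Coprime n m) {α : k} {a b : ℕ → k} (h : DiagCocycle n m α a b)
    (hI : CaseI n m α) :
    ∃ s t : k, DiagBoundary n m (a - (s • (1 : ℕ → k) + t • altCoeff k n m)) b := by
  obtain ⟨h1, h2⟩ := odd_of_even_add hcop hI.1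
  have he := hI.1
  -- The alternating sum has curvature -1 at 0, so adding `curv n m a b 0` times it makes the
  -- cochain flat.
  obtain ⟨s, hs⟩ := exists_diagBoundary_sub (a := a + curv n m a b 0 • altCoeff k n m) (b := b)
    hm hcop fun i hi => by
      obtain ⟨t, rfl⟩ := exists_mul_mod_eq hcop hi
      have hpar : t * n % (n + m) % 2 = t % 2 := by
        rw [Nat.mod_mod_of_dvd _ he.two_dvd, Nat.mul_mod, Nat.odd_iff.1 h1]
        simp
      have h3 := curv_add a b (curv n m a b 0 • altCoeff k n m) (curv n m a b 0 • 0)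
        (n := n) (m := m) (t * n % (n + m))
      rw [curv_smul, curv_altCoeff hnm hcop he hi, h.curv_mul hm, neg_one_pow_congr hpar, smul_zero,
        add_zero] at h3
      rw [h3]
      ring
  refine ⟨s, -curv n m a b 0, ?_⟩
  convert hs using 1
  module

theorem diagBoundary_caseI [CharZero k] (hm : 0 < m) (hnm : n ≤ m) (hcop : Nat.Coprime n m)
    (he : Even (n + m)) {s t : k}
    (h : DiagBoundary n m (s • (1 : ℕ → k) + t • altCoeff k n m) 0) : s = 0 ∧ t = 0 := by
  have h0 := h.curv_eq_zero (i := 0) (by omega)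
  have h3 := curv_add (s • (1 : ℕ → k)) (s • 0) (t • altCoeff k n m) (t • 0) (n := n) (m := m) 0
  rw [curv_smul, curv_smul, curv_one, curv_altCoeff hnm hcop he (by omega), smul_zero, smul_zero,
    add_zero, h0] at h3
  obtain rfl : t = 0 := by simpa using h3
  rw [zero_smul, add_zero] at h
  exact ⟨not_diagBoundary_smul_one hm h, rfl⟩

end DownUp

namespace DownUp

variable {k : Type u} [Field k] {n m : ℕ} {α β : k}

/-! ### The maps `y ↦ x ^ m` -/

theorem yxCocycle_zero : YXCocycle n m α β 0 := by simp [YXCocycle]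

theorem xyCocycle_zero : XYCocycle n m α β 0 := by simp [XYCocycle]

/-- The sequences (λ_j) and (βλ_{j-1}) solve the recursion with initial values (0, 1) and (1, 0).
The conditions left over at j = 0 are λ_{m+1} times two linear forms in b 0, b 1 of determinant α² +
4β. -/
theorem yxCocycle_iff (hβ : β ≠ 0) {b : ℕ → k} : YXCocycle 1 m α β b ↔
    (∀ j < m + 2, b j = b 1 * lam α β (j + 1) + b 0 * (β * lam α β j)) ∧
      lam α β (m + 2) * (2 * b 1 - α * b 0) = 0 ∧
      lam α β (m + 2) * (α * b 1 + 2 * β * b 0) = 0 := by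
  have hrec : (∀ i < m, b (i + 1 + 1) = α * b (i + 1) + β * b i) ↔
      ∀ j < m + 2, b j = b 1 * lam α β (j + 1) + b 0 * (β * lam α β j) := by
    constructor
    · intro h j
      induction j using Nat.twoStepInduction with
      | zero => simp [lam, hβ]
      | one => simp [lam, hβ]
      | more j h1 h2 =>
        intro hj
        rw [h j (by omega), h1 (by omega), h2 (by omega), lam_succ_succ (j + 1), lam_succ_succ j]
        ring
    · intro h i hi
      rw [h _ (by omega), h (i + 1) (by omega), h i (by omega), lam_succ_succ (i + 1),
        lam_succ_succ i]
      ring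
  rw [YXCocycle, hrec]
  refine and_congr_right fun h => ?_
  have h1 := h m (by omega)
  have h2 := h (m + 1) (by omega)
  have h3 := lam_succ_succ (α := α) (β := β) m
  constructor
  · intro H
    obtain ⟨e1, e2⟩ := H 0 one_pos
    rw [zero_add, add_comm 1 m, h2] at e1 e2
    rw [zero_add, h1] at e2
    refine ⟨by linear_combination e1, ?_⟩
    linear_combination (2 * β * b 0) * h3 - e2
  · rintro ⟨e1, e2⟩ j hj
    obtain rfl : j = 0 := by omega
    rw [zero_add, zero_add, add_comm 1 m, h2, h1]
    refine ⟨by linear_combination e1, ?_⟩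
    linear_combination (2 * β * b 0) * h3 - e2

/-- With zero discriminant, α/2 is a double root of the characteristic polynomial, so the solution
starting with 1, α/2 is geometric. -/
theorem lam_mul_half_add [CharZero k] (hβ : β ≠ 0) (h : α ^ 2 + 4 * β = 0) (j : ℕ) :
    α / 2 * lam α β (j + 1) + β * lam α β j = (α / 2) ^ j := by
  induction j using Nat.twoStepInduction with
  | zero => simp [lam, hβ]
  | one => simp [lam, hβ]
  | more j h1 h2 =>
    rw [lam_succ_succ (j + 1), lam_succ_succ j]
    rw [lam_succ_succ j] at h2
    linear_combination α * h2 + β * h1 + (α / 2) ^ j * h / 4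

theorem lam_even_eq_zero (j : ℕ) : lam (0 : k) β (2 * j + 1) = 0 := by
  induction j with
  | zero => rfl
  | succ j ih =>
    rw [show 2 * (j + 1) + 1 = 2 * j + 1 + 2 by ring, lam_succ_succ, ih]
    ring

theorem CaseI.case1 (h : CaseI 1 m α) : Case1 m α β := by
  obtain ⟨h, rfl⟩ := h
  obtain ⟨r, hr⟩ := h
  rw [Case1, show m + 2 = 2 * r + 1 by omega]
  exact lam_even_eq_zero r

theorem yxCocycle_lam_succ (hβ : β ≠ 0) (h : Case1 m α β) :
    YXCocycle 1 m α β fun j => lam α β (j + 1) := by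
  rw [Case1] at h
  rw [yxCocycle_iff hβ, h]
  simp [lam, hβ]

theorem yxCocycle_lam (hβ : β ≠ 0) (h : Case1 m α β) :
    YXCocycle 1 m α β (β • lam α β) := by
  rw [Case1] at h
  rw [yxCocycle_iff hβ, h]
  simp [hβ, lam]

theorem YXCocycle.eq_zero [CharZero k] (hβ : β ≠ 0) (h3 : Case3 m α β) {b : ℕ → k}
    (h : YXCocycle 1 m α β b) {j : ℕ} (hj : j < m + 2) : b j = 0 := by
  obtain ⟨h0, h1, h2⟩ := (yxCocycle_iff hβ).1 h
  replace h1 := (mul_eq_zero.1 h1).resolve_left h3.1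
  replace h2 := (mul_eq_zero.1 h2).resolve_left h3.1
  have hb0 : b 0 = 0 := (mul_eq_zero.1 (by linear_combination 2 * h2 - α * h1 :
    (α ^ 2 + 4 * β) * b 0 = 0)).resolve_left h3.2
  have hb1 : b 1 = 0 := by
    rw [hb0, mul_zero, sub_zero] at h1
    exact (mul_eq_zero.1 h1).resolve_left two_ne_zero
  rw [h0 j hj, hb0, hb1]
  ring

theorem YXCocycle.eq_pow [CharZero k] (hβ : β ≠ 0) (h2 : Case2 m α β) {b : ℕ → k}
    (h : YXCocycle 1 m α β b) {j : ℕ} (hj : j < m + 2) : b j = b 0 * (α / 2) ^ j := by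
  obtain ⟨h0, h1, -⟩ := (yxCocycle_iff hβ).1 h
  replace h1 := (mul_eq_zero.1 h1).resolve_left h2.1
  have hb1 : b 1 = α / 2 * b 0 := by linear_combination h1 / 2
  rw [h0 j hj, ← lam_mul_half_add hβ h2.2, hb1]
  ring

theorem yxCocycle_pow [CharZero k] (hβ : β ≠ 0) (h2 : α ^ 2 + 4 * β = 0) :
    YXCocycle 1 m α β fun j => (α / 2) ^ j := by
  rw [yxCocycle_iff hβ]
  refine ⟨fun j _ => ?_, ?_, ?_⟩
  · rw [← lam_mul_half_add hβ h2]
    ring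
  · ring
  · linear_combination lam α β (m + 2) * h2 / 2

/-! ### The maps `x ↦ y` -/

/-- In this form the last two equations disappear for α = 0. For α ≠ 0 they express a 1 and a 0
through a 2, and the first becomes (α² + 4β) a 2 = 0. -/
theorem xyCocycle_one_one_iff {a : ℕ → k} : XYCocycle 1 1 α β a ↔
    a 0 = α * a 1 + β * a 2 ∧ α * (2 * a 1 - α * a 2) = 0 ∧ α * (a 0 + β * a 2) = 0 := by
  simp only [XYCocycle, Nat.lt_one_iff, forall_eq, zero_add, Nat.reduceAdd]
  constructor
  · rintro ⟨⟨h1, h2⟩, h3⟩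
    exact ⟨h3, by linear_combination h1 - h3, by linear_combination -h2⟩
  · rintro ⟨h3, h1, h2⟩
    exact ⟨⟨by linear_combination h1 + h3, by linear_combination -h2⟩, h3⟩

end DownUp

/-! ### Assembling the bases case by case -/

namespace DownUp

variable {k : Type u} [Field k] {n m : ℕ} {α β : k}

theorem diagCocycle_one : DiagCocycle n m α (1 : ℕ → k) 0 :=
  diagCocycle_of_curv_eq_zero fun _ _ => curv_one _

theorem diagCocycle_zero : DiagCocycle n m α (0 : ℕ → k) 0 :=
  diagCocycle_of_curv_eq_zero fun _ _ => by simp [curv]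

variable [CharZero k]

theorem not_isCoboundary_sumX (hn : 1 ≤ n) (hnm : n ≤ m) (hβ : β ≠ 0) :
    ¬ IsCoboundary n m α β (sumX α β) := fun h => by
  have h1 := ((hasCoeffs_sumX.isCoboundary_iff hn hnm hβ).1 h).1
  rw [← one_smul k (1 : ℕ → k)] at h1
  exact one_ne_zero (not_diagBoundary_smul_one (hn.trans hnm) h1)

/-- The basis in Case II when the maps `x ↦ y` and `y ↦ x ^ m` do not contribute. -/
theorem isHHBasis_sumX (hn : 1 ≤ n) (hnm : n ≤ m) (hcop : Nat.Coprime n m) (hβ : β ≠ 0)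
    (hII : ¬ CaseI n m α)
    (hxy : n = 1 → m = 1 → ∀ p : ℕ → k, XYCocycle n m α β p → ∀ r < n + 2 * m, p r = 0)
    (hyx : n = 1 → ∀ q : ℕ → k, YXCocycle n m α β q → ∀ r < 2 * n + m, q r = 0) :
    IsHHBasis n m α β ![sumX α β] := by
  have hm := hn.trans hnm
  refine isHHBasis_of_hasCoeffs hn hnm hcop hβ (a := ![1]) (a' := ![0]) (b := ![0]) (b' := ![0])
    (fun i => ?_) (fun i => ?_) (fun c h _ _ => ?_) fun p p' q q' h1 h2 h3 h4 h5 => ?_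
  · fin_cases i
    exact hasCoeffs_sumX
  · fin_cases i
    exact ⟨diagCocycle_one, xyCocycle_zero, yxCocycle_zero⟩
  · simp at h
    funext i
    fin_cases i
    exact not_diagBoundary_smul_one hm h
  · obtain ⟨s, hs⟩ := exists_diagBoundary_of_not_caseI hm hcop h1 hII
    refine ⟨![s], by simpa using hs, fun r hr => ?_, fun r hr => ?_⟩
    · rcases h4 with ⟨e1, e2⟩ | rfl
      · simpa using hxy e1 e2 p' h2 r hr
      · simp
    · rcases h5 with e | rfl
      · simpa using hyx e q' h3 r hr
      · simp

/-- The basis in Case I when the maps `x ↦ y` and `y ↦ x ^ m` do not contribute. -/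
theorem isHHBasis_sumX_altX (hn : 1 < n) (hnm : n < m) (hcop : Nat.Coprime n m) (hβ : β ≠ 0)
    (hI : CaseI n m α) : IsHHBasis n m α β ![sumX α β, altX α β] := by
  have hm : 0 < m := by omega
  refine isHHBasis_of_hasCoeffs hn.le hnm.le hcop hβ (a := ![1, altCoeff k n m]) (a' := ![0, 0])
    (b := ![0, 0]) (b' := ![0, 0])
    (fun i => ?_) (fun i => ?_) (fun c h _ _ => ?_) fun p p' q q' h1 h2 h3 h4 h5 => ?_
  · fin_cases i
    exacts [hasCoeffs_sumX, hasCoeffs_altX]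
  · fin_cases i
    exacts [⟨diagCocycle_one, xyCocycle_zero, yxCocycle_zero⟩,
      ⟨diagCocycle_altCoeff hnm.le hcop hI, xyCocycle_zero, yxCocycle_zero⟩]
  · simp [Fin.sum_univ_succ] at h
    obtain ⟨e1, e2⟩ := diagBoundary_caseI hm hnm.le hcop hI.1 h
    funext i
    fin_cases i
    exacts [e1, e2]
  · obtain ⟨s, t, hs⟩ := exists_diagBoundary_of_caseI hm hnm.le hcop h1 hI
    obtain rfl := h4.resolve_left (by omega)
    obtain rfl := h5.resolve_left (by omega)
    exact ⟨![s, t], by simpa [Fin.sum_univ_succ] using hs, fun r hr => by simp, fun r hr => by simp⟩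

/-- The basis for `m > n = 1` in Case I. -/
theorem isHHBasis_one_caseI (hm : 1 < m) (hβ : β ≠ 0) (hI : CaseI 1 m α) : IsHHBasis 1 m α β
    ![sumX α β, altX α β, ∑ j : Fin (2 * 1 + m), lam α β (j + 1) • tauYX α β rfl j,
      β • ∑ j : Fin (2 * 1 + m), lam α β j • tauYX α β rfl j] := by
  have hcop := Nat.coprime_one_left m
  have h1 : Case1 m α β := hI.case1
  refine isHHBasis_of_hasCoeffs le_rfl hm.le hcop hβ (a := ![1, altCoeff k 1 m, 0, 0])
    (a' := ![0, 0, 0, 0]) (b := ![0, 0, 0, 0])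
    (b' := ![0, 0, fun j => lam α β (j + 1), β • lam α β])
    (fun i => ?_) (fun i => ?_) (fun c h _ h' => ?_) fun p p' q q' h2 _ h3 h4 _ => ?_
  · fin_cases i
    exacts [hasCoeffs_sumX, hasCoeffs_altX, hasCoeffs_sum_tauYX rfl fun j => lam α β (j + 1),
      by
        have h := (hasCoeffs_sum_tauYX (m := m) (α := α) (β := β) rfl (lam α β)).smul β
        simp only [smul_zero] at h
        exact h]
  · fin_cases i
    exacts [⟨diagCocycle_one, xyCocycle_zero, yxCocycle_zero⟩,
      ⟨diagCocycle_altCoeff hm.le hcop hI, xyCocycle_zero, yxCocycle_zero⟩,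
      ⟨diagCocycle_zero, xyCocycle_zero, yxCocycle_lam_succ hβ h1⟩,
      ⟨diagCocycle_zero, xyCocycle_zero, yxCocycle_lam hβ h1⟩]
  · simp [Fin.sum_univ_succ] at h
    obtain ⟨e1, e2⟩ := diagBoundary_caseI (by omega) hm.le hcop hI.1 h
    -- At indices 0 and 1 the two λ-families take the values (0, 1) and (1, 0), so evaluation at 1
    -- and 0 reads off their coefficients. For spanning, the same evaluations give the witnesses q'
    -- 1 and q' 0.
    have e3 := h' 1 (by omega)
    have e4 := h' 0 (by omega)
    simp [Fin.sum_univ_succ, lam, hβ] at e3 e4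
    funext i
    fin_cases i
    exacts [e1, e2, e3, e4]
  · obtain ⟨s, t, hs⟩ := exists_diagBoundary_of_caseI (by omega) hm.le hcop h2 hI
    obtain rfl := h4.resolve_left (by omega)
    refine ⟨![s, t, q' 1, q' 0], by simpa [Fin.sum_univ_succ] using hs,
      fun r hr => by simp [Fin.sum_univ_succ], fun r hr => ?_⟩
    rw [((yxCocycle_iff hβ).1 h3).1 r (by omega)]
    simp [Fin.sum_univ_succ]

/-- The basis for `m > n = 1` in Cases II and 1. -/
theorem isHHBasis_one_case1 (hm : 1 < m) (hβ : β ≠ 0) (hII : ¬ CaseI 1 m α) (h1 : Case1 m α β) :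
    IsHHBasis 1 m α β ![sumX α β, ∑ j : Fin (2 * 1 + m), lam α β (j + 1) • tauYX α β rfl j,
      β • ∑ j : Fin (2 * 1 + m), lam α β j • tauYX α β rfl j] := by
  have hcop := Nat.coprime_one_left m
  refine isHHBasis_of_hasCoeffs le_rfl hm.le hcop hβ (a := ![1, 0, 0])
    (a' := ![0, 0, 0]) (b := ![0, 0, 0])
    (b' := ![0, fun j => lam α β (j + 1), β • lam α β])
    (fun i => ?_) (fun i => ?_) (fun c h _ h' => ?_) fun p p' q q' h2 _ h3 h4 _ => ?_
  · fin_cases i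
    exacts [hasCoeffs_sumX, hasCoeffs_sum_tauYX rfl fun j => lam α β (j + 1),
      by
        have h := (hasCoeffs_sum_tauYX (m := m) (α := α) (β := β) rfl (lam α β)).smul β
        simp only [smul_zero] at h
        exact h]
  · fin_cases i
    exacts [⟨diagCocycle_one, xyCocycle_zero, yxCocycle_zero⟩,
      ⟨diagCocycle_zero, xyCocycle_zero, yxCocycle_lam_succ hβ h1⟩,
      ⟨diagCocycle_zero, xyCocycle_zero, yxCocycle_lam hβ h1⟩]
  · simp [Fin.sum_univ_succ] at h
    have e1 := not_diagBoundary_smul_one (by omega) h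
    have e3 := h' 1 (by omega)
    have e4 := h' 0 (by omega)
    simp [Fin.sum_univ_succ, lam, hβ] at e3 e4
    funext i
    fin_cases i
    exacts [e1, e3, e4]
  · obtain ⟨s, hs⟩ := exists_diagBoundary_of_not_caseI (by omega) hcop h2 hII
    obtain rfl := h4.resolve_left (by omega)
    refine ⟨![s, q' 1, q' 0], by simpa [Fin.sum_univ_succ] using hs,
      fun r hr => by simp [Fin.sum_univ_succ], fun r hr => ?_⟩
    rw [((yxCocycle_iff hβ).1 h3).1 r (by omega)]
    simp [Fin.sum_univ_succ]

/-- The basis for `m > n = 1` in Cases II and 2. -/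
theorem isHHBasis_one_case2 (hm : 1 < m) (hβ : β ≠ 0) (hII : ¬ CaseI 1 m α) (h1 : Case2 m α β) :
    IsHHBasis 1 m α β ![sumX α β,
      ∑ j : Fin (2 * 1 + m), (α / 2) ^ (j : ℕ) • tauYX α β rfl j] := by
  have hcop := Nat.coprime_one_left m
  refine isHHBasis_of_hasCoeffs le_rfl hm.le hcop hβ (a := ![1, 0])
    (a' := ![0, 0]) (b := ![0, 0]) (b' := ![0, fun j => (α / 2) ^ j])
    (fun i => ?_) (fun i => ?_) (fun c h _ h' => ?_) fun p p' q q' h2 _ h3 h4 _ => ?_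
  · fin_cases i
    exacts [hasCoeffs_sumX, hasCoeffs_sum_tauYX rfl fun j => (α / 2) ^ j]
  · fin_cases i
    exacts [⟨diagCocycle_one, xyCocycle_zero, yxCocycle_zero⟩,
      ⟨diagCocycle_zero, xyCocycle_zero, yxCocycle_pow hβ h1.2⟩]
  · simp [Fin.sum_univ_succ] at h
    have e1 := not_diagBoundary_smul_one (by omega) h
    have e3 := h' 0 (by omega)
    simp [Fin.sum_univ_succ] at e3
    funext i
    fin_cases i
    exacts [e1, e3]
  · obtain ⟨s, hs⟩ := exists_diagBoundary_of_not_caseI (by omega) hcop h2 hII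
    obtain rfl := h4.resolve_left (by omega)
    refine ⟨![s, q' 0], by simpa [Fin.sum_univ_succ] using hs,
      fun r hr => by simp [Fin.sum_univ_succ], fun r hr => ?_⟩
    rw [h3.eq_pow hβ h1 (by omega)]
    simp [Fin.sum_univ_succ]

/-- The basis for `m = n = 1` in Case I. -/
theorem isHHBasis_one_one_caseI (hβ : β ≠ 0) (hI : CaseI 1 1 α) : IsHHBasis 1 1 α β
    ![sumX α β, tauX α β ⟨1, by omega⟩, tauYX α β rfl ⟨1, by omega⟩,
      β • tauYX α β rfl ⟨2, by omega⟩ + tauYX α β rfl ⟨0, by omega⟩,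
      tauXY α β rfl rfl ⟨1, by omega⟩,
      tauXY α β rfl rfl ⟨2, by omega⟩ + β • tauXY α β rfl rfl ⟨0, by omega⟩] := by
  have h1 : Case1 1 α β := hI.case1
  -- For n = m = 1 the alternating sum has a single term, so τ_{x_2} takes the place of δ.
  have halt : altCoeff k 1 1 = Pi.single 1 1 := by
    funext i
    by_cases hi : i = 1
    · simp [altCoeff, hi]
    · rw [altCoeff, if_neg (by omega), Pi.single_eq_of_ne hi]
  obtain ⟨-, rfl⟩ := id hI
  refine isHHBasis_of_hasCoeffs le_rfl le_rfl (Nat.coprime_one_left 1) hβ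
    (a := ![1, Pi.single 1 1, 0, 0, 0, 0])
    (a' := ![0, 0, 0, 0, Pi.single 1 1, Pi.single 2 1 + β • Pi.single 0 1])
    (b := ![0, 0, 0, 0, 0, 0])
    (b' := ![0, 0, Pi.single 1 1, β • Pi.single 2 1 + Pi.single 0 1, 0, 0])
    (fun i => ?_) (fun i => ?_) (fun c h h' h'' => ?_) fun p p' q q' h2 h3 h4 _ _ => ?_
  · fin_cases i
    exacts [hasCoeffs_sumX, hasCoeffs_tauX _, hasCoeffs_tauYX rfl _,
      by
        have h := ((hasCoeffs_tauYX (n := 1) (m := 1) (α := 0) (β := β) rfl ⟨2, by omega⟩).smul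
          β).add (hasCoeffs_tauYX rfl ⟨0, by omega⟩)
        simp only [smul_zero, add_zero] at h
        exact h,
      hasCoeffs_tauXY rfl rfl _,
      by
        have h := (hasCoeffs_tauXY (n := 1) (m := 1) (α := 0) (β := β) rfl rfl ⟨2, by omega⟩).add
          ((hasCoeffs_tauXY rfl rfl ⟨0, by omega⟩).smul β)
        simp only [smul_zero, add_zero] at h
        exact h]
  -- Here λ_2 = α = 0, so the extra conditions are void and only one step of the recursion remains.
  · have hyx (b : ℕ → k) (hb : b 2 = β * b 0) : YXCocycle 1 1 0 β b := by
      rw [Case1] at h1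
      rw [yxCocycle_iff hβ, h1]
      refine ⟨fun j hj => ?_, by simp, by simp⟩
      interval_cases j <;> simp [lam, hβ, hb, mul_comm]
    have hxy (a : ℕ → k) (ha : a 0 = β * a 2) : XYCocycle 1 1 0 β a := by
      rw [xyCocycle_one_one_iff, ha]
      simp
    fin_cases i
    exacts [⟨diagCocycle_one, xyCocycle_zero, yxCocycle_zero⟩,
      ⟨halt ▸ diagCocycle_altCoeff le_rfl (Nat.coprime_one_left 1) hI, xyCocycle_zero,
        yxCocycle_zero⟩,
      ⟨diagCocycle_zero, xyCocycle_zero, hyx _ (by simp)⟩,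
      ⟨diagCocycle_zero, xyCocycle_zero, hyx _ (by simp)⟩,
      ⟨diagCocycle_zero, hxy _ (by simp), yxCocycle_zero⟩,
      ⟨diagCocycle_zero, hxy _ (by simp), yxCocycle_zero⟩]
  · simp [Fin.sum_univ_succ] at h
    rw [← halt] at h
    obtain ⟨e1, e2⟩ := diagBoundary_caseI one_pos le_rfl (Nat.coprime_one_left 1) hI.1 h
    have e3 := h'' 1 (by omega)
    have e4 := h'' 0 (by omega)
    have e5 := h' 1 (by omega)
    have e6 := h' 2 (by omega)
    simp [Fin.sum_univ_succ] at e3 e4 e5 e6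
    funext i
    fin_cases i
    exacts [e1, e2, e3, e4, e5, e6]
  · obtain ⟨s, t, hs⟩ := exists_diagBoundary_of_caseI one_pos le_rfl (Nat.coprime_one_left 1) h2 hI
    rw [halt] at hs
    have h5 := (xyCocycle_one_one_iff.1 h3).1
    have h6 := h4.1 0 one_pos
    simp at h5 h6
    refine ⟨![s, t, q' 1, q' 0, p' 1, p' 2], by simpa [Fin.sum_univ_succ] using hs,
      fun r hr => ?_, fun r hr => ?_⟩
    · interval_cases r <;> simp [Fin.sum_univ_succ, h5, mul_comm]
    · interval_cases r <;> simp [Fin.sum_univ_succ, h6, mul_comm]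

/-- The basis for `m = n = 1` in Cases II and 2. -/
theorem isHHBasis_one_one_case2 (hβ : β ≠ 0) (hII : ¬ CaseI 1 1 α) (h1 : Case2 1 α β) :
    IsHHBasis 1 1 α β ![sumX α β,
        (α / 2) ^ 2 • tauYX α β rfl ⟨2, by omega⟩ + (α / 2) • tauYX α β rfl ⟨1, by omega⟩ +
          tauYX α β rfl ⟨0, by omega⟩,
        tauXY α β rfl rfl ⟨2, by omega⟩ + (α / 2) • tauXY α β rfl rfl ⟨1, by omega⟩ +
          (α / 2) ^ 2 • tauXY α β rfl rfl ⟨0, by omega⟩] := by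
  -- As n + m = 2 is even, Case II means α ≠ 0, which allows α to be cancelled from the equations
  -- for x ↦ y.
  have hα : α ≠ 0 := fun h => hII ⟨even_two, h⟩
  refine isHHBasis_of_hasCoeffs le_rfl le_rfl (Nat.coprime_one_left 1) hβ (a := ![1, 0, 0])
    (a' := ![0, 0, Pi.single 2 1 + (α / 2) • Pi.single 1 1 + (α / 2) ^ 2 • Pi.single 0 1])
    (b := ![0, 0, 0])
    (b' := ![0, fun j => (α / 2) ^ j, 0])
    (fun i => ?_) (fun i => ?_) (fun c h h' h'' => ?_) fun p p' q q' h2 h3 h4 _ _ => ?_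
  · fin_cases i
    · exact hasCoeffs_sumX
    · have h := (((hasCoeffs_tauYX (α := α) (β := β) (n := 1) (m := 1) rfl ⟨2, by omega⟩).smul
        ((α / 2) ^ 2)).add ((hasCoeffs_tauYX rfl ⟨1, by omega⟩).smul (α / 2))).add
          (hasCoeffs_tauYX rfl ⟨0, by omega⟩)
      refine h.congr (by simp) (by simp) (by simp) fun j hj => ?_
      interval_cases j <;> simp
    · have h := ((hasCoeffs_tauXY (n := 1) (m := 1) (α := α) (β := β) rfl rfl ⟨2, by omega⟩).add
        ((hasCoeffs_tauXY rfl rfl ⟨1, by omega⟩).smul (α / 2))).add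
          ((hasCoeffs_tauXY rfl rfl ⟨0, by omega⟩).smul ((α / 2) ^ 2))
      simp only [smul_zero, add_zero] at h
      exact h
  · fin_cases i
    · exact ⟨diagCocycle_one, xyCocycle_zero, yxCocycle_zero⟩
    · exact ⟨diagCocycle_zero, xyCocycle_zero, yxCocycle_pow hβ h1.2⟩
    · refine ⟨diagCocycle_zero, xyCocycle_one_one_iff.2 ?_, yxCocycle_zero⟩
      simp
      have h2 := h1.2
      refine ⟨by linear_combination -h2 / 4, by right; ring, by right; linear_combination h2 / 4⟩
  · simp [Fin.sum_univ_succ] at h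
    have e1 := not_diagBoundary_smul_one one_pos h
    have e2 := h'' 0 (by omega)
    have e3 := h' 2 (by omega)
    simp [Fin.sum_univ_succ] at e2 e3
    funext i
    fin_cases i
    exacts [e1, e2, e3]
  · obtain ⟨s, hs⟩ := exists_diagBoundary_of_not_caseI one_pos (Nat.coprime_one_left 1) h2 hII
    obtain ⟨-, h5, h6⟩ := xyCocycle_one_one_iff.1 h3
    replace h5 := (mul_eq_zero.1 h5).resolve_left hα
    replace h6 := (mul_eq_zero.1 h6).resolve_left hα
    refine ⟨![s, q' 0, p' 2], by simpa [Fin.sum_univ_succ] using hs, fun r hr => ?_,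
      fun r hr => ?_⟩
    · have h7 := h1.2
      interval_cases r <;> simp [Fin.sum_univ_succ]
      · linear_combination h6 - p' 2 * h7 / 4
      · linear_combination h5 / 2
    · rw [h4.eq_pow hβ h1 (by omega)]
      simp [Fin.sum_univ_succ]

theorem XYCocycle.eq_zero (hα : α ≠ 0) (h3 : α ^ 2 + 4 * β ≠ 0) {a : ℕ → k}
    (h : XYCocycle 1 1 α β a) {i : ℕ} (hi : i < 3) : a i = 0 := by
  obtain ⟨e1, e2, e3⟩ := xyCocycle_one_one_iff.1 h
  replace e2 := (mul_eq_zero.1 e2).resolve_left hα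
  replace e3 := (mul_eq_zero.1 e3).resolve_left hα
  have h2 : a 2 = 0 := (mul_eq_zero.1 (by linear_combination 2 * e3 - 2 * e1 - α * e2 :
    (α ^ 2 + 4 * β) * a 2 = 0)).resolve_left h3
  rw [h2, mul_zero, sub_zero] at e2
  rw [h2, mul_zero, add_zero] at e3
  have h1 := (mul_eq_zero.1 e2).resolve_left two_ne_zero
  interval_cases i <;> assumption

end DownUp

end

open DownUp in
theorem mainTheorem4 {k : Type u} [Field k] [IsAlgClosed k] [CharZero k] (n m : ℕ) (hn : 1 ≤ n)
    (hnm : n ≤ m) (hcop : Nat.Coprime n m) (α β : k) (hβ : β ≠ 0) :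
    -- the cochain `∑ τ_{x_r}` is never a coboundary
    ¬ IsCoboundary n m α β (sumX α β) ∧
    -- `n = m = 1`
    (∀ (h1 : n = 1) (h2 : m = 1),
      (CaseI n m α → IsHHBasis n m α β ![sumX α β, tauX α β ⟨1, by omega⟩,
        tauYX α β h1 ⟨1, by omega⟩,
        β • tauYX α β h1 ⟨2, by omega⟩ + tauYX α β h1 ⟨0, by omega⟩,
        tauXY α β h1 h2 ⟨1, by omega⟩,
        tauXY α β h1 h2 ⟨2, by omega⟩ + β • tauXY α β h1 h2 ⟨0, by omega⟩]) ∧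
      (¬ CaseI n m α → Case2 m α β → IsHHBasis n m α β ![sumX α β,
        (α / 2) ^ 2 • tauYX α β h1 ⟨2, by omega⟩ + (α / 2) • tauYX α β h1 ⟨1, by omega⟩ +
          tauYX α β h1 ⟨0, by omega⟩,
        tauXY α β h1 h2 ⟨2, by omega⟩ + (α / 2) • tauXY α β h1 h2 ⟨1, by omega⟩ +
          (α / 2) ^ 2 • tauXY α β h1 h2 ⟨0, by omega⟩]) ∧
      (¬ CaseI n m α → Case3 m α β → IsHHBasis n m α β ![sumX α β])) ∧
    -- `m > n = 1`
    (∀ h1 : n = 1, n < m →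
      (CaseI n m α → IsHHBasis n m α β ![sumX α β, altX α β,
        ∑ j : Fin (2 * n + m), lam α β (j + 1) • tauYX α β h1 j,
        β • ∑ j : Fin (2 * n + m), lam α β j • tauYX α β h1 j]) ∧
      (¬ CaseI n m α → Case1 m α β → IsHHBasis n m α β ![sumX α β,
        ∑ j : Fin (2 * n + m), lam α β (j + 1) • tauYX α β h1 j,
        β • ∑ j : Fin (2 * n + m), lam α β j • tauYX α β h1 j]) ∧
      (¬ CaseI n m α → Case2 m α β → IsHHBasis n m α β ![sumX α β,
        ∑ j : Fin (2 * n + m), (α / 2) ^ (j : ℕ) • tauYX α β h1 j]) ∧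
      (¬ CaseI n m α → Case3 m α β → IsHHBasis n m α β ![sumX α β])) ∧
    -- `m > n > 1`
    (1 < n → n < m →
      (CaseI n m α → IsHHBasis n m α β ![sumX α β, altX α β]) ∧
      (¬ CaseI n m α → IsHHBasis n m α β ![sumX α β])) := by
  refine ⟨not_isCoboundary_sumX hn hnm hβ, ?_, ?_, ?_⟩
  · rintro rfl rfl
    refine ⟨isHHBasis_one_one_caseI hβ, isHHBasis_one_one_case2 hβ, fun hII h3 =>
      isHHBasis_sumX hn hnm hcop hβ hII (fun _ _ p hp r hr => ?_) fun _ q hq r hr => ?_⟩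
    · exact hp.eq_zero (fun h => hII ⟨even_two, h⟩) h3.2 hr
    · exact hq.eq_zero hβ h3 (by omega)
  · rintro rfl hm
    refine ⟨isHHBasis_one_caseI hm hβ, isHHBasis_one_case1 hm hβ, isHHBasis_one_case2 hm hβ,
      fun hII h3 => isHHBasis_sumX hn hnm hcop hβ hII (fun _ h1 => by omega)
        fun _ q hq r hr => hq.eq_zero hβ h3 (by omega)⟩
  · intro h1 hm
    exact ⟨isHHBasis_sumX_altX h1 hm hcop hβ, fun hII =>
      isHHBasis_sumX hn hnm hcop hβ hII (fun h => by omega) fun h => by omega⟩
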